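/- Let $K$ be a field and let $S=K[x_1,\dots,x_r]$ be the polynomial ring graded by $\deg(x_i)=d_i$, where $d_1\ge d_2\ge\cdots\ge d_r$ are positive integers. Let $M$ be a finitely generated $\mathbb{Z}$-graded Cohen--Macaulay $S$-module of Krull dimension $s$. Then the Hilbert series $H(M,t)=\sum_{e\in\mathbb{Z}}\dim_K(M_e)\,t^e$ is a rational function; let $a(M)$ be its degree (degree of the numerator minus degree of the denominator, and $-\infty$ if $M=0$). For every $i\ge 0$, $$\deg\bigl(\operatorname{Tor}^S_i(M,K)\bigr)\le d_1+d_2+\cdots+d_{s+i}+a(M).$$ Here $K=S/(x_1,\dots,x_r)$ is placed in degree $0$, $\operatorname{Tor}^S_i(M,K)$ is graded as the $i$-th homology of $F_\bullet\otimes_S K$ for any graded free resolution $F_\bullet$ of $M$, $\deg(V)$ is the largest degree in which the graded vector space $V$ is nonzero ($-\infty$ if $V=0$), and $d_j$ is read as $0$ for $j>r$. For $M=0$ both sides are $-\infty$, and $s$ may be any natural number. -/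

import Mathlib

universe u v w

noncomputable section

namespace SyzygyBound

/-! ### Cohen-Macaulay modules -/

/-- The depth of a module over a local ring: the supremum of the lengths of the regular
sequences contained in the maximal ideal. -/
def depth (R : Type u) [CommRing R] [IsLocalRing R] (M : Type v) [AddCommGroup M] [Module R M] :
    ℕ∞ :=
  ⨆ rs ∈ {rs : List R | (∀ x ∈ rs, x ∈ IsLocalRing.maximalIdeal R) ∧
    RingTheory.Sequence.IsRegular M rs}, (rs.length : ℕ∞)

/-- A finitely generated module over a Noetherian local ring is Cohen-Macaulay
if it is zero or its depth equals its dimension. -/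
def IsLocalCohenMacaulay (R : Type u) [CommRing R] [IsLocalRing R]
    (M : Type v) [AddCommGroup M] [Module R M] : Prop :=
  Subsingleton M ∨ (depth R M : WithBot ℕ∞) = Module.supportDim R M

/-- A finitely generated module over a Noetherian ring is Cohen-Macaulay
if all its localizations at maximal ideals are. -/
def IsCohenMacaulay (R : Type u) [CommRing R] (M : Type v) [AddCommGroup M] [Module R M] : Prop :=
  ∀ (P : Ideal R) [P.IsMaximal],
    IsLocalCohenMacaulay (Localization.AtPrime P) (LocalizedModule P.primeCompl M)

/-! ### The weighted polynomial ring -/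

/-- The grading of `K[x₁, …, x_r]` with `deg x_j = d_j`, indexed by `ℤ`
(the pieces of negative degree are zero). -/
abbrev polyGrading (K : Type u) [Field K] {r : ℕ} (d : Fin r → ℕ) :
    ℤ → Submodule K (MvPolynomial (Fin r) K) :=
  MvPolynomial.weightedHomogeneousSubmodule K (fun j => (d j : ℤ))

/-- The degree `e` piece of the graded free module `⨁ⱼ S(-deg j)`
with basis elements of degrees `deg j`. -/
def freePiece {K : Type u} [Field K] {r : ℕ} (d : Fin r → ℕ) {ι : Type w} (deg : ι → ℤ) (e : ℤ) :
    Submodule K (ι →₀ MvPolynomial (Fin r) K) where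
  carrier := {f | ∀ j, f j ∈ polyGrading K d (e - deg j)}
  zero_mem' := fun _ => Submodule.zero_mem _
  add_mem' := fun hf hg j => Submodule.add_mem _ (hf j) (hg j)
  smul_mem' := fun c _ hf j => Submodule.smul_mem _ c (hf j)

/-! ### Graded Tor -/

/-- A graded free resolution `⋯ → F₁ → F₀ → M → 0` of the graded module `M = ⨁ₑ ℳ e` over
`S = K[x₁, …, x_r]`, `deg x_j = d_j`: here `F n` has a homogeneous basis `ι n`, and all maps are
homogeneous of degree `0`. -/
structure GradedFreeResolution {K : Type u} [Field K] {r : ℕ} (d : Fin r → ℕ)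
    {M : Type v} [AddCommGroup M] [Module K M] [Module (MvPolynomial (Fin r) K) M]
    (ℳ : ℤ → Submodule K M) where
  /-- the index set of the homogeneous basis of `F n` -/
  ι : ℕ → Type w
  /-- the degrees of the basis elements -/
  deg : (n : ℕ) → ι n → ℤ
  /-- the differential `F (n + 1) → F n` -/
  diff : (n : ℕ) → (ι (n + 1) →₀ MvPolynomial (Fin r) K) →ₗ[MvPolynomial (Fin r) K]
    (ι n →₀ MvPolynomial (Fin r) K)
  /-- the augmentation `F 0 → M` -/
  aug : (ι 0 →₀ MvPolynomial (Fin r) K) →ₗ[MvPolynomial (Fin r) K] M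
  diff_mem : ∀ (n : ℕ) (j : ι (n + 1)),
    diff n (Finsupp.single j 1) ∈ freePiece (K := K) d (deg n) (deg (n + 1) j)
  aug_mem : ∀ j : ι 0, aug (Finsupp.single j 1) ∈ ℳ (deg 0 j)
  aug_surjective : Function.Surjective aug
  exact_zero : Function.Exact (diff 0) aug
  exact_succ : ∀ n : ℕ, Function.Exact (diff (n + 1)) (diff n)

namespace GradedFreeResolution

variable {K : Type u} [Field K] {r : ℕ} {d : Fin r → ℕ}
  {M : Type v} [AddCommGroup M] [Module K M] [Module (MvPolynomial (Fin r) K) M]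
  {ℳ : ℤ → Submodule K M} (F : GradedFreeResolution.{u, v, w} d ℳ)

/-- The vector space `F i ⊗ K`, where `K = K[x₁, …, x_r] / (x₁, …, x_r)`: since `F i` is the free
module on `ι i`, this is the vector space with basis `ι i`. -/
abbrev Chain (i : ℕ) : Type (max u w) := F.ι i →₀ K

/-- The differential `F (i + 1) ⊗ K → F i ⊗ K`: its matrix is the matrix of `F (i + 1) → F i`
with all entries reduced modulo `(x₁, …, x_r)`. -/
def chainDiff (i : ℕ) : F.Chain (i + 1) →ₗ[K] F.Chain i :=
  Finsupp.linearCombination K fun j =>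
    (F.diff i (Finsupp.single j 1)).mapRange MvPolynomial.constantCoeff (map_zero _)

/-- The cycles of the complex `F ⊗ K`. -/
def cycles : (i : ℕ) → Submodule K (F.Chain i)
  | 0 => ⊤
  | i + 1 => LinearMap.ker (F.chainDiff i)

/-- The boundaries of the complex `F ⊗ K`. -/
def boundaries (i : ℕ) : Submodule K (F.Chain i) :=
  LinearMap.range (F.chainDiff i)

/-- The degree `e` piece of `F i ⊗ K` (with `K` in degree `0`):
it is spanned by the basis elements of degree `e`. -/
def chainPiece (i : ℕ) (e : ℤ) : Submodule K (F.Chain i) :=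
  Finsupp.supported K K {j | F.deg i j = e}

/-- `Tor_i(M, K)`, the `i`-th homology (cycles modulo boundaries) of `F ⊗ K`,
as a subspace of `F i ⊗ K` modulo boundaries. -/
def Tor (i : ℕ) : Submodule K (F.Chain i ⧸ F.boundaries i) :=
  (F.cycles i).map (F.boundaries i).mkQ

/-- The degree `e` piece of `Tor_i(M, K)`: the classes of the cycles of degree `e`. -/
def torPiece (i : ℕ) (e : ℤ) : Submodule K (F.Chain i ⧸ F.boundaries i) :=
  (F.chainPiece i e ⊓ F.cycles i).map (F.boundaries i).mkQ

end GradedFreeResolution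

/-! ### Degrees -/

/-- The degree of a graded vector space: the largest `e` whose piece is non-zero,
and `-∞` for the zero space. -/
def gradedDegree {K : Type u} [Field K] {V : Type v} [AddCommGroup V] [Module K V]
    (𝒱 : ℤ → Submodule K V) : WithBot (WithTop ℤ) :=
  ⨆ e ∈ {e : ℤ | 𝒱 e ≠ ⊥}, ((e : WithTop ℤ) : WithBot (WithTop ℤ))

/-- The rational function `H` is the Hilbert series `∑ₑ dim(ℳ e) tᵉ`:
the pieces are finite-dimensional, and their dimensions are the coefficients
of the Laurent expansion of `H` at `t = 0`. -/
def IsHilbertSeries {K : Type u} [Field K] {M : Type v} [AddCommGroup M] [Module K M]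
    (ℳ : ℤ → Submodule K M) (H : RatFunc ℚ) : Prop :=
  ∀ e : ℤ, Module.Finite K (ℳ e) ∧
    (H : LaurentSeries ℚ).coeff e = (Module.finrank K (ℳ e) : ℚ)

/-- The degree of a rational function: numerator degree minus denominator degree,
and `-∞` for zero. -/
def ratDegree (H : RatFunc ℚ) : WithBot (WithTop ℤ) :=
  open Classical in if H = 0 then ⊥ else ((H.intDegree : WithTop ℤ) : WithBot (WithTop ℤ))

end SyzygyBound

end

/-! ### Local algebra: depth, dimension and localization. -/

namespace SyzygyBound

open RingTheory.Sequence IsLocalRing CategoryTheory Abelian Limits Pointwise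

/-! Let 𝔪 = (x₁, …, x_r). The proof is an induction on n = dim M_𝔪 (n = 0 if M_𝔪 = 0); by the
Cohen-Macaulay hypothesis M_𝔪 has a regular sequence of length n when n > 0.

If n = 0, then M is finite-dimensional over K, so its Hilbert series is a Laurent polynomial and
a(M) is the top degree of M. Take a resolution F and kill the variables one at a time. By the long
exact sequence of multiplication by a variable, passing from F/(x₁, …, x_k)F to F/(x₁, …, x_{k+1})F
adds to H_i at most a copy of H_{i-1} shifted by d_{k+1}. A class in H_i thus accumulates the shifts
of at most i distinct variables, and d₁ + ⋯ + d_i is the largest such sum because the d_j decrease.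
This is `BigradedComplex.homologyVanishes_of_le`.

If n > 0, then 𝔪 is not associated to M, and homogeneous prime avoidance gives an M-regular form f
of degree a > 0. Dimension and regular sequence length both drop by one for M/fM, and H(M/fM, t) =
(1 - t^a) H(M, t), so a(M/fM) = a(M) + a for M ≠ 0. The cone of f on F resolves M/fM
(`BigradedComplex.Resolves.cone`). As f is zero on F ⊗ K, Tor_i(M, K) in degree e embeds into
Tor_{i+1}(M/fM, K) in degree e + a (`BigradedComplex.HomologyVanishes.of_cone`). The bound for M/fM
at (n - 1, i + 1) is the bound for M at (n, i), shifted by a. The induction is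
`exists_hilbertSeries_and_bound`. -/

theorem exists_isRegular_quotSMulTop {R : Type u} [CommRing R] [IsLocalRing R] [IsNoetherianRing R]
    {N : Type (max u v)} [AddCommGroup N] [Module R N] [Module.Finite R N] {n : ℕ}
    (h : ∃ rs : List R, rs.length = n + 1 ∧ (∀ x ∈ rs, x ∈ maximalIdeal R) ∧ IsRegular N rs)
    {f : R} (hf : f ∈ maximalIdeal R) (hreg : IsSMulRegular N f) :
    ∃ rs : List R, rs.length = n ∧ (∀ x ∈ rs, x ∈ maximalIdeal R) ∧
      IsRegular (QuotSMulTop f N) rs := by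
  have : Small.{max u v} R := small_max.{v} R
  have hN : Nontrivial N := by
    obtain ⟨rs, -, -, hrs⟩ := h
    exact hrs.nontrivial
  have smul_lt (L : Type (max u v)) [AddCommGroup L] [Module R L] [Module.Finite R L]
      [Nontrivial L] : maximalIdeal R • (⊤ : Submodule R L) < ⊤ :=
    lt_top_iff_ne_top.mpr fun e => top_ne_bot
      (Submodule.eq_bot_of_le_smul_of_le_jacobson_bot (maximalIdeal R) (⊤ : Submodule R L)
        Module.Finite.fg_top e.ge (IsLocalRing.maximalIdeal_le_jacobson _))
  have : Nontrivial (QuotSMulTop f N) := by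
    have hlt := smul_lt N
    refine Submodule.Quotient.nontrivial_iff.mpr fun e => hlt.ne (top_le_iff.mp (e.ge.trans ?_))
    rw [← Submodule.ideal_span_singleton_smul]
    exact Submodule.smul_mono_left ((Ideal.span_singleton_le_iff_mem _).mpr hf)
  -- Regular sequences of a given length are detected by vanishing of Ext from the residue field, so
  -- the new sequence need not extend f. `Shrink` only places the residue field in the universe of
  -- N.
  let k : ModuleCat.{max u v} R := ModuleCat.of R (Shrink.{max u v} (R ⧸ maximalIdeal R))
  have hk : Module.Finite R k :=
    Module.Finite.equiv (Shrink.linearEquiv R (R ⧸ maximalIdeal R)).symm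
  have hsupp : Module.support R k = PrimeSpectrum.zeroLocus (maximalIdeal R) := by
    rw [(Shrink.linearEquiv R (R ⧸ maximalIdeal R)).support_eq, Module.support_eq_zeroLocus,
      Ideal.annihilator_quotient]
  obtain ⟨rs, hlen, hmem, hrs⟩ := h
  have h2 : ∀ i < n + 1, Subsingleton (Ext k (ModuleCat.of R N) i) := by
    rw [← hlen]
    exact ModuleCat.subsingleton_ext_of_exists_isRegular (maximalIdeal R) k hsupp.subset
      (ModuleCat.of R N) (smul_lt N) rs hmem hrs
  refine ModuleCat.exists_isRegular_of_exists_subsingleton_ext (maximalIdeal R) n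
    (ModuleCat.of R (QuotSMulTop f N)) (smul_lt _) k hsupp fun i hi => ?_
  -- Ext^i(k, N/fN) sits between Ext^i(k, N) and Ext^{i+1}(k, N), so one degree of vanishing is
  -- lost.
  have zero1 := AddCommGrpCat.isZero_of_iff_subsingleton.mpr (h2 i (by omega))
  have zero2 := AddCommGrpCat.isZero_of_iff_subsingleton.mpr (h2 (i + 1) (by omega))
  exact AddCommGrpCat.subsingleton_of_isZero <| ShortComplex.Exact.isZero_of_both_zeros
    ((Ext.covariant_sequence_exact₃' _
      (IsSMulRegular.smulShortComplex_shortExact (M := ModuleCat.of R N) hreg)) i (i + 1) rfl)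
    (zero1.eq_zero_of_src _) (zero2.eq_zero_of_tgt _)

theorem exists_maximalIdeal_pow_smul_eq_zero {R : Type u} [CommRing R] [IsLocalRing R]
    [IsNoetherianRing R] {N : Type v} [AddCommGroup N] [Module R N] [Module.Finite R N]
    (h : Module.supportDim R N ≤ 0) :
    ∃ k : ℕ, ∀ x ∈ maximalIdeal R ^ k, ∀ y : N, x • y = 0 := by
  rcases subsingleton_or_nontrivial N with hN | hN
  · exact ⟨0, fun _ _ _ => Subsingleton.elim _ _⟩
  have h0 : Module.supportDim R N = 0 := by
    refine le_antisymm h ?_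
    have := Module.supportDim_ne_bot_of_nontrivial R N
    cases hx : Module.supportDim R N with
    | bot => exact absurd hx this
    | coe a => exact_mod_cast bot_le
  have hs := support_of_supportDim_eq_zero R N h0
  rw [Module.support_eq_zeroLocus, PrimeSpectrum.zeroLocus_eq_iff] at hs
  have hle : maximalIdeal R ≤ (Module.annihilator R N).radical := hs ▸ Ideal.le_radical
  obtain ⟨k, hk⟩ := Ideal.exists_pow_le_of_le_radical_of_fg hle (IsNoetherian.noetherian _)
  exact ⟨k, fun x hx y => Module.mem_annihilator.mp (hk hx) y⟩

/-- The localization of `M / f M` is the quotient of the localization of `M` by `f`. -/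
noncomputable def localizedQuotSMulTopEquiv {R : Type u} [CommRing R] (P : Ideal R) [P.IsPrime] (M : Type v)
    [AddCommGroup M] [Module R M] (f : R) :
    LocalizedModule P.primeCompl (QuotSMulTop f M) ≃ₗ[Localization.AtPrime P]
      QuotSMulTop (algebraMap R (Localization.AtPrime P) f) (LocalizedModule P.primeCompl M) :=
  (IsLocalizedModule.isBaseChange P.primeCompl (Localization.AtPrime P)
    (LocalizedModule.mkLinearMap P.primeCompl (QuotSMulTop f M))).equiv.symm ≪≫ₗ
  (QuotSMulTop.algebraMapTensorEquivTensorQuotSMulTop f M (Localization.AtPrime P)).symm ≪≫ₗ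
    QuotSMulTop.congr (algebraMap R (Localization.AtPrime P) f)
    (IsLocalizedModule.isBaseChange P.primeCompl (Localization.AtPrime P)
    (LocalizedModule.mkLinearMap P.primeCompl M)).equiv

/-- Contraction of primes is strictly monotone and sends the support of the localization into the
support of M. -/
theorem supportDim_localizedModule_le {R : Type u} [CommRing R] (P : Ideal R) [P.IsPrime]
    (M : Type v) [AddCommGroup M] [Module R M] [Module.Finite R M] :
    Module.supportDim (Localization.AtPrime P) (LocalizedModule P.primeCompl M) ≤
      Module.supportDim R M := by
  have hmem : ∀ p : Module.support (Localization.AtPrime P) (LocalizedModule P.primeCompl M),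
      p.1.comap (algebraMap R (Localization.AtPrime P)) ∈ Module.support R M := by
    intro p
    rw [Module.support_eq_zeroLocus, PrimeSpectrum.mem_zeroLocus]
    intro x hx
    refine Module.annihilator_le_of_mem_support p.2 ?_
    rw [SetLike.mem_coe, Module.mem_annihilator] at hx
    rw [Module.mem_annihilator]
    intro y
    obtain ⟨⟨m, s⟩, rfl⟩ := IsLocalizedModule.mk'_surjective P.primeCompl
      (LocalizedModule.mkLinearMap P.primeCompl M) y
    rw [algebraMap_smul, Function.uncurry_apply_pair, ← IsLocalizedModule.mk'_smul, hx,
      IsLocalizedModule.mk'_zero]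
  refine Order.krullDim_le_of_strictMono (fun p => ⟨_, hmem p⟩) fun p q hpq => ?_
  refine lt_of_le_of_ne (Ideal.comap_mono hpq.le) fun e => hpq.ne (Subtype.ext ?_)
  exact PrimeSpectrum.localization_comap_injective _ P.primeCompl (congrArg Subtype.val e)

/-- A finite positive supremum of lengths is attained. For n = 0 the supremum may be over the empty
set, which is why that case is excluded. -/
theorem exists_isRegular_length_eq {R : Type u} [CommRing R] [IsLocalRing R] {N : Type v}
    [AddCommGroup N] [Module R N] {n : ℕ} (hn : n ≠ 0) (h : depth R N = n) :
    ∃ rs : List R, rs.length = n ∧ (∀ x ∈ rs, x ∈ maximalIdeal R) ∧ IsRegular N rs := by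
  by_contra! hne
  have hle : depth R N ≤ (n - 1 : ℕ) := by
    refine iSup₂_le fun rs hrs => ?_
    have hlt : (rs.length : ℕ∞) ≤ n := by
      rw [← h]
      exact le_iSup₂ (f := fun (rs : List R) _ => (rs.length : ℕ∞)) rs hrs
    have h1 : rs.length ≠ n := fun e => hne rs e hrs.1 hrs.2
    have h2 : rs.length ≤ n := by exact_mod_cast hlt
    exact_mod_cast (by omega : rs.length ≤ n - 1)
  rw [h] at hle
  have : n ≤ n - 1 := by exact_mod_cast hle
  omega

end SyzygyBound

noncomputable section

namespace SyzygyBound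

open MvPolynomial Pointwise

/-! ### Graded modules over the weighted polynomial ring. -/

section Grading

variable {K : Type u} [Field K] {r : ℕ} {d : Fin r → ℕ}

/-- The family `π` consists of the projections onto the homogeneous components of a grading
of the module `M` over the weighted polynomial ring. -/
structure IsGrading (d : Fin r → ℕ) {M : Type v} [AddCommGroup M] [Module K M]
    [Module (MvPolynomial (Fin r) K) M] (π : ℤ → M →ₗ[K] M) : Prop where
  idem : ∀ e m, π e (π e m) = π e m
  orth : ∀ e e' m, e ≠ e' → π e (π e' m) = 0
  smul : ∀ a e (p : MvPolynomial (Fin r) K) m, p ∈ polyGrading K d a →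
    π (e + a) (p • m) = p • π e m
  mem_iSup : ∀ m, m ∈ ⨆ e, LinearMap.range (π e)

theorem weight_nonneg (d : Fin r → ℕ) (α : Fin r →₀ ℕ) :
    0 ≤ Finsupp.weight (fun j => (d j : ℤ)) α := by
  rw [Finsupp.weight_eq_sum]
  exact Finset.sum_nonneg fun i _ => by positivity

theorem weight_eq_zero_iff (hd : ∀ j, 0 < d j) {α : Fin r →₀ ℕ} :
    Finsupp.weight (fun j => (d j : ℤ)) α = 0 ↔ α = 0 := by
  refine ⟨fun h => ?_, fun h => by rw [h, map_zero]⟩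
  rw [Finsupp.weight_eq_sum, Finset.sum_eq_zero_iff_of_nonneg (fun i _ => by positivity)] at h
  ext i
  have := h i (Finset.mem_univ i)
  have hi := hd i
  simpa [hi.ne'] using this

theorem monomial_mem_polyGrading (α : Fin r →₀ ℕ) (c : K) :
    monomial α c ∈ polyGrading K d (Finsupp.weight (fun j => (d j : ℤ)) α) :=
  isWeightedHomogeneous_monomial _ _ _ rfl

theorem polyGrading_mul_mem {a b : ℤ} {p q : MvPolynomial (Fin r) K} (hp : p ∈ polyGrading K d a)
    (hq : q ∈ polyGrading K d b) : p * q ∈ polyGrading K d (a + b) :=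
  IsWeightedHomogeneous.mul hp hq

theorem constantCoeff_eq_zero_of_mem {a : ℤ} {p : MvPolynomial (Fin r) K}
    (hp : p ∈ polyGrading K d a) (ha : a ≠ 0) : constantCoeff p = 0 := by
  by_contra h
  exact ha (by simpa using (hp h).symm)

theorem mem_idealOfVars_iff {p : MvPolynomial (Fin r) K} :
    p ∈ idealOfVars (Fin r) K ↔ constantCoeff p = 0 := by
  rw [idealOfVars, ← Set.image_univ, mem_ideal_span_X_image]
  refine ⟨fun h => ?_, fun h α hα => ?_⟩
  · by_contra h0
    obtain ⟨i, -, hi⟩ := h 0 (mem_support_iff.mpr h0)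
    exact hi rfl
  · by_contra! hne
    have : α = 0 := Finsupp.ext fun i => hne i trivial
    rw [this, mem_support_iff] at hα
    exact hα h

instance idealOfVars_isMaximal : (idealOfVars (Fin r) K).IsMaximal := by
  have : idealOfVars (Fin r) K =
      RingHom.ker (constantCoeff : MvPolynomial (Fin r) K →+* K) :=
    Ideal.ext fun p => mem_idealOfVars_iff
  rw [this]
  exact RingHom.ker_isMaximal_of_surjective _ fun c => ⟨C c, constantCoeff_C _ c⟩

namespace IsGrading

variable {M : Type v} [AddCommGroup M] [Module K M] [Module (MvPolynomial (Fin r) K) M]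
  {π : ℤ → M →ₗ[K] M}

theorem smul' (h : IsGrading d π) {a e : ℤ} {p : MvPolynomial (Fin r) K}
    (hp : p ∈ polyGrading K d a) (m : M) : π e (p • m) = p • π (e - a) m := by
  rw [← h.smul a (e - a) p m hp, sub_add_cancel]

theorem eq_zero_of_ne (h : IsGrading d π) {e e' : ℤ} {m : M} (hm : π e m = m) (hne : e' ≠ e) :
    π e' m = 0 := by
  rw [← hm]
  exact h.orth _ _ _ hne

theorem exists_finset (h : IsGrading d π) (m : M) : ∃ I : Finset ℤ,
    (∀ e ∉ I, π e m = 0) ∧ ∑ e ∈ I, π e m = m := by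
  have key : ∃ I : Finset ℤ, ∀ J, I ⊆ J → ∑ e ∈ J, π e m = m := by
    refine Submodule.iSup_induction (fun e => LinearMap.range (π e))
      (motive := fun m => ∃ I : Finset ℤ, ∀ J, I ⊆ J → ∑ e ∈ J, π e m = m) (h.mem_iSup m) ?_ ?_ ?_
    · rintro e _ ⟨m, rfl⟩
      refine ⟨{e}, fun J hJ => ?_⟩
      rw [Finset.sum_eq_single_of_mem e (hJ (by simp)) fun b _ hb => h.orth _ _ _ hb, h.idem]
    · exact ⟨∅, fun J _ => by simp⟩
    · rintro x y ⟨I, hI⟩ ⟨I', hI'⟩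
      refine ⟨I ∪ I', fun J hJ => ?_⟩
      simp only [map_add, Finset.sum_add_distrib]
      rw [hI J (Finset.subset_union_left.trans hJ), hI' J (Finset.subset_union_right.trans hJ)]
  obtain ⟨I, hI⟩ := key
  have hs := hI I subset_rfl
  refine ⟨I, fun e he => ?_, hs⟩
  rw [← hs, map_sum]
  exact Finset.sum_eq_zero fun e' he' => h.orth _ _ _ fun heq => he (heq ▸ he')

/-- All weights are positive, so only the constant term of p preserves the degree of m. Consequently
an element outside the irrelevant ideal, homogeneous or not, kills no nonzero homogeneous element.
-/
theorem apply_smul_of_homogeneous [IsScalarTower K (MvPolynomial (Fin r) K) M]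
    (hd : ∀ j, 0 < d j) (h : IsGrading d π) {e : ℤ} {m : M}
    (hm : π e m = m) (p : MvPolynomial (Fin r) K) : π e (p • m) = constantCoeff p • m := by
  induction p using MvPolynomial.induction_on' with
  | monomial α c =>
    rw [h.smul' (monomial_mem_polyGrading α c)]
    by_cases h0 : α = 0
    · subst h0
      rw [map_zero, sub_zero, hm, constantCoeff_monomial, if_pos rfl, ← C_apply, ← algebraMap_eq,
        algebraMap_smul]
    · rw [constantCoeff_monomial, if_neg h0, zero_smul, h.eq_zero_of_ne hm, smul_zero]
      intro heq
      exact h0 ((weight_eq_zero_iff hd).mp (by linarith))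
  | add p q hp hq => rw [add_smul, map_add, hp, hq, map_add, add_smul]

theorem eq_zero_of_smul_eq_zero [IsScalarTower K (MvPolynomial (Fin r) K) M]
    (hd : ∀ j, 0 < d j) (h : IsGrading d π) {e : ℤ} {m : M}
    (hm : π e m = m) {p : MvPolynomial (Fin r) K} (hp : p ∉ idealOfVars (Fin r) K)
    (hpm : p • m = 0) : m = 0 := by
  have := h.apply_smul_of_homogeneous hd hm p
  rw [hpm, map_zero, eq_comm, smul_eq_zero] at this
  exact this.resolve_left fun h0 => hp (mem_idealOfVars_iff.mpr h0)

/-- Multiplication by a polynomial never lowers degrees, so the degrees of finitely many generators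
bound everything from below. -/
theorem exists_lower_bound [Module.Finite (MvPolynomial (Fin r) K) M] (h : IsGrading d π) :
    ∃ b : ℤ, ∀ e < b, ∀ m, π e m = 0 := by
  obtain ⟨G, hG⟩ := Module.Finite.fg_top (R := MvPolynomial (Fin r) K) (M := M)
  choose I hI using fun m => (h.exists_finset m)
  obtain ⟨b, hb⟩ := (G.biUnion I).bddBelow
  refine ⟨b, fun e he m => ?_⟩
  have hm : m ∈ Submodule.span (MvPolynomial (Fin r) K) (G : Set M) := hG ▸ trivial
  induction hm using Submodule.span_induction generalizing e with
  | mem g hg =>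
    refine (hI g).1 e fun heI => ?_
    exact absurd (hb (Finset.mem_coe.mpr (Finset.mem_biUnion.mpr ⟨g, hg, heI⟩))) (not_le.mpr he)
  | zero => exact map_zero _
  | add x y _ _ hx hy => rw [map_add, hx e he, hy e he, add_zero]
  | smul p x _ hx =>
    induction p using MvPolynomial.induction_on' with
    | monomial α c =>
      rw [h.smul' (monomial_mem_polyGrading α c), hx, smul_zero]
      have := weight_nonneg d α
      linarith
    | add p q hp hq => rw [add_smul, map_add, hp, hq, add_zero]

theorem exists_upper_bound [Module.Finite K M] (h : IsGrading d π) :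
    ∃ I : Finset ℤ, ∀ e ∉ I, ∀ m, π e m = 0 := by
  obtain ⟨G, hG⟩ := Module.Finite.fg_top (R := K) (M := M)
  choose I hI using fun m => (h.exists_finset m)
  refine ⟨G.biUnion I, fun e he m => ?_⟩
  have hm : m ∈ Submodule.span K (G : Set M) := hG ▸ trivial
  induction hm using Submodule.span_induction with
  | mem g hg => exact (hI g).1 e fun heI => he (Finset.mem_biUnion.mpr ⟨g, hg, heI⟩)
  | zero => exact map_zero _
  | add x y _ _ hx hy => rw [map_add, hx, hy, add_zero]
  | smul c x _ hx => rw [map_smul, hx, smul_zero]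

end IsGrading

/-- The projections of the quotient `M / f M`. -/
def quotientProj {M : Type v} [AddCommGroup M] [Module K M] [Module (MvPolynomial (Fin r) K) M]
    [IsScalarTower K (MvPolynomial (Fin r) K) M] {π : ℤ → M →ₗ[K] M} (h : IsGrading d π)
    {f : MvPolynomial (Fin r) K} {a : ℤ} (hf : f ∈ polyGrading K d a) (e : ℤ) :
    QuotSMulTop f M →ₗ[K] QuotSMulTop f M :=
  (((f • (⊤ : Submodule (MvPolynomial (Fin r) K) M)).restrictScalars K).liftQ
    (((f • (⊤ : Submodule (MvPolynomial (Fin r) K) M)).mkQ.restrictScalars K) ∘ₗ π e) (by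
      rintro m hm
      obtain ⟨x, -, rfl⟩ := (Submodule.mem_smul_pointwise_iff_exists _ _ _).mp
        ((Submodule.restrictScalars_mem _ _ _).mp hm)
      rw [LinearMap.mem_ker, LinearMap.comp_apply, h.smul' hf]
      exact (Submodule.Quotient.mk_eq_zero _).mpr
        (Submodule.smul_mem_pointwise_smul _ _ _ trivial))) ∘ₗ
  (Submodule.Quotient.restrictScalarsEquiv K
    (f • (⊤ : Submodule (MvPolynomial (Fin r) K) M))).symm.toLinearMap

section Quotient

variable {M : Type v} [AddCommGroup M] [Module K M] [Module (MvPolynomial (Fin r) K) M]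
    [IsScalarTower K (MvPolynomial (Fin r) K) M] {π : ℤ → M →ₗ[K] M}
    {f : MvPolynomial (Fin r) K} {a : ℤ}

theorem quotientProj_mk (h : IsGrading d π) (hf : f ∈ polyGrading K d a) (e : ℤ) (m : M) :
    quotientProj h hf e (Submodule.Quotient.mk m) = Submodule.Quotient.mk (π e m) := rfl

theorem isGrading_quotientProj (h : IsGrading d π) (hf : f ∈ polyGrading K d a) :
    IsGrading d (quotientProj h hf) where
  idem e := (Submodule.Quotient.mk_surjective _).forall.mpr fun m => by
    rw [quotientProj_mk, quotientProj_mk, h.idem]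
  orth e e' := (Submodule.Quotient.mk_surjective _).forall.mpr fun m hne => by
    rw [quotientProj_mk, quotientProj_mk, h.orth _ _ _ hne, Submodule.Quotient.mk_zero]
  smul b e p := (Submodule.Quotient.mk_surjective _).forall.mpr fun m hp => by
    rw [← Submodule.Quotient.mk_smul, quotientProj_mk, quotientProj_mk, h.smul _ _ _ _ hp,
      Submodule.Quotient.mk_smul]
  mem_iSup := (Submodule.Quotient.mk_surjective _).forall.mpr fun m => by
    obtain ⟨I, -, hI⟩ := h.exists_finset m
    rw [← hI, ← Submodule.mkQ_apply, map_sum]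
    exact Submodule.sum_mem _ fun e _ => Submodule.mem_iSup_of_mem e
      ⟨Submodule.Quotient.mk m, quotientProj_mk h hf e m⟩

end Quotient

/-- Homogeneous prime avoidance. A variable outside P guarantees a form of positive degree outside P
even when P is the only prime. -/
theorem exists_homogeneous_notMem (A : Finset (Ideal (MvPolynomial (Fin r) K)))
    (hd : ∀ j, 0 < d j) (hA : ∀ P ∈ A, P.IsPrime ∧ ∃ j : Fin r, X j ∉ P) :
    ∃ a : ℕ, 0 < a ∧ ∃ f ∈ polyGrading K d a, ∀ P ∈ A, f ∉ P := by
  classical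
  have pow_mem {f : MvPolynomial (Fin r) K} {a : ℕ} (hf : f ∈ polyGrading K d a) (n : ℕ) :
      f ^ n ∈ polyGrading K d ((n * a : ℕ) : ℤ) := by
    have := IsWeightedHomogeneous.pow hf n
    simpa using this
  induction hn : A.card using Nat.strong_induction_on generalizing A with
  | _ n ih =>
  subst hn
  rcases A.eq_empty_or_nonempty with rfl | ⟨P, hP⟩
  -- With no prime to avoid, the zero form will do.
  · exact ⟨1, one_pos, 0, Submodule.zero_mem _, by simp⟩
  by_contra! hno
  have step : ∀ Q ∈ A, ∃ a : ℕ, 0 < a ∧ ∃ f ∈ polyGrading K d a, f ∈ Q ∧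
      ∀ P ∈ A, P ≠ Q → f ∉ P := by
    intro Q hQ
    obtain ⟨a, ha, f, hf, hfQ⟩ := ih _ (Finset.card_erase_lt_of_mem hQ) (A.erase Q)
      (fun P hP => hA P (Finset.mem_of_mem_erase hP)) rfl
    have hfQ' : ∀ P ∈ A, P ≠ Q → f ∉ P := fun P hP hne => hfQ P (Finset.mem_erase.mpr ⟨hne, hP⟩)
    obtain ⟨P, hP, hfP⟩ := hno a ha f hf
    by_cases hPQ : P = Q
    · exact ⟨a, ha, f, hf, hPQ ▸ hfP, hfQ'⟩
    · exact absurd hfP (hfQ' P hP hPQ)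
  -- If avoidance fails, each Q has a form f Q lying in Q and in no other prime of the family.
  choose! a ha f hf hfQ hfP using step
  obtain ⟨hPp, j, hj⟩ := hA P hP
  have hg : X j * ∏ Q ∈ A.erase P, f Q ∈
      polyGrading K d ((d j + ∑ Q ∈ A.erase P, a Q : ℕ) : ℤ) := by
    rw [Nat.cast_add, Nat.cast_sum]
    exact polyGrading_mul_mem (isWeightedHomogeneous_X _ _ j)
      (IsWeightedHomogeneous.prod _ _ _ fun Q hQ => hf Q (Finset.mem_of_mem_erase hQ))
  set g := X j * ∏ Q ∈ A.erase P, f Q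
  set b := d j + ∑ Q ∈ A.erase P, a Q
  have hb : 0 < b := Nat.add_pos_left (hd j) _
  have hgP : g ∉ P := by
    intro h
    refine (hPp.mem_or_mem h).elim hj fun h => ?_
    obtain ⟨Q, hQ, hfQP⟩ := hPp.prod_mem_iff.mp h
    exact hfP Q (Finset.mem_of_mem_erase hQ) P hP (Finset.ne_of_mem_erase hQ).symm hfQP
  have hgQ : ∀ Q ∈ A, Q ≠ P → g ∈ Q := fun Q hQ hne =>
    Q.mul_mem_left _ (Ideal.mem_of_dvd _ (Finset.dvd_prod_of_mem f
      (Finset.mem_erase.mpr ⟨hne, hQ⟩)) (hfQ Q hQ))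
  -- The exponents give both summands degree `a P * b`. At every prime exactly one summand is a
  -- member: the first at P, the second at each other prime.
  obtain ⟨Q, hQ, hQm⟩ := hno (a P * b) (Nat.mul_pos (ha P hP) hb) (f P ^ b + g ^ a P)
    (Submodule.add_mem _ (by rw [mul_comm]; exact pow_mem (hf P hP) b) (pow_mem hg _))
  have hQp := (hA Q hQ).1
  by_cases hQP : Q = P
  · subst hQP
    rw [Ideal.add_mem_iff_right _ (Ideal.pow_mem_of_mem _ (hfQ Q hQ) _ hb)] at hQm
    exact hgP (hQp.mem_of_pow_mem _ hQm)
  · rw [Ideal.add_mem_iff_left _ (Ideal.pow_mem_of_mem _ (hgQ Q hQ hQP) _ (ha P hP))] at hQm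
    exact hfP P hP Q hQ hQP (hQp.mem_of_pow_mem _ hQm)

/-- Non-regular elements form the union of the finitely many associated primes. One containing all
variables would equal the irrelevant ideal by maximality, so prime avoidance applies. -/
theorem exists_homogeneous_isSMulRegular {M : Type v} [AddCommGroup M]
    [Module (MvPolynomial (Fin r) K) M] [Module.Finite (MvPolynomial (Fin r) K) M]
    (hd : ∀ j, 0 < d j) (hM : idealOfVars (Fin r) K ∉ associatedPrimes (MvPolynomial (Fin r) K) M) :
    ∃ a : ℕ, 0 < a ∧ ∃ f ∈ polyGrading K d a, IsSMulRegular M f := by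
  have hfin := associatedPrimes.finite (MvPolynomial (Fin r) K) M
  obtain ⟨a, ha, f, hf, hfP⟩ := exists_homogeneous_notMem (d := d) hfin.toFinset hd (by
    intro P hP
    rw [Set.Finite.mem_toFinset] at hP
    refine ⟨IsAssociatedPrime.isPrime hP, ?_⟩
    by_contra! hX
    refine hM ?_
    have hle : idealOfVars (Fin r) K ≤ P := by
      rw [idealOfVars, Ideal.span_le]
      rintro _ ⟨j, rfl⟩
      exact hX j
    rwa [idealOfVars_isMaximal.eq_of_le (IsAssociatedPrime.isPrime hP).ne_top hle])
  refine ⟨a, ha, f, hf, ?_⟩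
  by_contra hreg
  have : f ∈ ⋃ p ∈ associatedPrimes (MvPolynomial (Fin r) K) M, (p : Set _) := by
    rw [biUnion_associatedPrimes_eq_compl_regular]
    exact hreg
  simp only [Set.mem_iUnion] at this
  obtain ⟨P, hP, hfm⟩ := this
  exact hfP P (hfin.mem_toFinset.mpr hP) hfm

end Grading

end SyzygyBound

end

noncomputable section

namespace SyzygyBound

open MvPolynomial Pointwise IsLocalRing

/-! ### Comparison with the localization at the irrelevant ideal. -/

section Localization

variable {K : Type u} [Field K] {r : ℕ} {d : Fin r → ℕ}
  {M : Type v} [AddCommGroup M] [Module (MvPolynomial (Fin r) K) M]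

/-- Otherwise the maximal ideal of the localization would be an associated prime containing the
first, regular, element of the sequence. -/
theorem idealOfVars_notMem_associatedPrimes {rs : List (Localization.AtPrime (idealOfVars (Fin r) K))}
    (hne : rs ≠ []) (hmem : ∀ x ∈ rs, x ∈ maximalIdeal _)
    (hreg : RingTheory.Sequence.IsRegular (LocalizedModule (idealOfVars (Fin r) K).primeCompl M) rs) :
    idealOfVars (Fin r) K ∉ associatedPrimes (MvPolynomial (Fin r) K) M := by
  intro h
  have h' := Module.associatedPrimes.mem_associatedPrimes_atPrime_of_mem_associatedPrimes h
  obtain ⟨x, rs, rfl⟩ := List.exists_cons_of_ne_nil hne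
  rw [RingTheory.Sequence.isRegular_cons_iff] at hreg
  have hx : x ∈ ⋃ p ∈ associatedPrimes (Localization.AtPrime (idealOfVars (Fin r) K))
      (LocalizedModule (idealOfVars (Fin r) K).primeCompl M), (p : Set _) :=
    Set.mem_biUnion h' (hmem x List.mem_cons_self)
  rw [biUnion_associatedPrimes_eq_compl_regular] at hx
  exact hx hreg.1

variable [Module K M] {π : ℤ → M →ₗ[K] M}

theorem IsGrading.eq_zero_of_mkLinearMap_eq_zero [IsScalarTower K (MvPolynomial (Fin r) K) M]
    (hd : ∀ j, 0 < d j) (h : IsGrading d π) {e : ℤ} {m : M} (hm : π e m = m)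
    (h0 : LocalizedModule.mkLinearMap (idealOfVars (Fin r) K).primeCompl M m = 0) : m = 0 := by
  obtain ⟨c, hc⟩ := (IsLocalizedModule.eq_zero_iff (idealOfVars (Fin r) K).primeCompl _).mp h0
  exact h.eq_zero_of_smul_eq_zero hd hm c.2 hc

/-- A power of the maximal ideal kills the localization. Nonzero homogeneous elements survive
localization, so monomials of large total degree already kill M, and the remaining monomials times
generators span M over K. -/
theorem IsGrading.finite_of_supportDim_le_zero [IsScalarTower K (MvPolynomial (Fin r) K) M]
    [Module.Finite (MvPolynomial (Fin r) K) M] (hd : ∀ j, 0 < d j) (h : IsGrading d π)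
    (hdim : Module.supportDim (Localization.AtPrime (idealOfVars (Fin r) K))
      (LocalizedModule (idealOfVars (Fin r) K).primeCompl M) ≤ 0) : Module.Finite K M := by
  classical
  obtain ⟨k, hk⟩ := exists_maximalIdeal_pow_smul_eq_zero hdim
  have hmon : ∀ (α : Fin r →₀ ℕ) (c : K) (m : M), k ≤ α.degree → monomial α c • m = 0 := by
    intro α c m hα
    have hαk : monomial α c ∈ idealOfVars (Fin r) K ^ k := by
      by_cases hc : c = 0
      · rw [hc, monomial_zero]; exact Ideal.zero_mem _
      · exact (monomial_mem_pow_idealOfVars_iff _ _ hc).mpr hα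
    have hmax : algebraMap _ (Localization.AtPrime (idealOfVars (Fin r) K)) (monomial α c) ∈
        maximalIdeal (Localization.AtPrime (idealOfVars (Fin r) K)) ^ k := by
      rw [← Localization.AtPrime.map_eq_maximalIdeal, ← Ideal.map_pow]
      exact Ideal.mem_map_of_mem _ hαk
    obtain ⟨I, -, hI⟩ := h.exists_finset m
    rw [← hI, Finset.smul_sum]
    refine Finset.sum_eq_zero fun e _ => ?_
    refine h.eq_zero_of_mkLinearMap_eq_zero hd
      (e := e + Finsupp.weight (fun j => (d j : ℤ)) α) ?_ ?_
    · rw [h.smul _ _ _ _ (monomial_mem_polyGrading α c), h.idem]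
    · rw [map_smul, ← algebraMap_smul (Localization.AtPrime (idealOfVars (Fin r) K))]
      exact hk _ hmax _
  obtain ⟨G, hG⟩ := Module.Finite.fg_top (R := MvPolynomial (Fin r) K) (M := M)
  have hfin : {α : Fin r →₀ ℕ | α.degree ≤ k}.Finite := Finsupp.finite_of_degree_le k
  refine ⟨⟨(hfin.toFinset ×ˢ G).image fun x => monomial x.1 (1 : K) • x.2, ?_⟩⟩
  refine top_le_iff.mp fun m _ => ?_
  have hm : m ∈ Submodule.span (MvPolynomial (Fin r) K) (G : Set M) := hG ▸ trivial
  obtain ⟨p, -, rfl⟩ := Submodule.mem_span_finset.mp hm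
  refine Submodule.sum_mem _ fun g hg => ?_
  induction p g using MvPolynomial.induction_on' with
  | monomial α c =>
    by_cases hα : k ≤ α.degree
    · rw [hmon α c g hα]; exact Submodule.zero_mem _
    · have : monomial α c = c • monomial α (1 : K) := by rw [smul_monomial, smul_eq_mul, mul_one]
      rw [this, smul_assoc]
      refine Submodule.smul_mem _ _ (Submodule.subset_span ?_)
      rw [Finset.coe_image]
      exact ⟨(α, g), by simpa [hg] using (not_le.mp hα).le, rfl⟩
  | add p q hp hq => rw [add_smul]; exact Submodule.add_mem _ hp hq

end Localization

/-! ### Bigraded complexes: killing variables, and cones. -/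

section Complex

variable {K : Type u} [Field K] {r : ℕ} (d : Fin r → ℕ)

/-- A complex of graded modules, given by its total module `T`, with the submodules
`(x₁, …, x_k) T` of a module on which `x₁, …, x_r` is a regular sequence. -/
structure BigradedComplex (K : Type u) [Field K] {r : ℕ} (d : Fin r → ℕ)
    (T : Type w) [AddCommGroup T] [Module (MvPolynomial (Fin r) K) T] where
  /-- the elements of homological degree `n` and internal degree `e` -/
  piece : ℤ → ℤ → AddSubgroup T
  /-- the differential -/
  diff : T →ₗ[MvPolynomial (Fin r) K] T
  /-- the submodule `(x₁, …, x_k) T` -/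
  filt : ℕ → Submodule (MvPolynomial (Fin r) K) T
  eq_zero_of_neg : ∀ {n e t}, n < 0 → t ∈ piece n e → t = 0
  smul_mem : ∀ {a n e t} {p : MvPolynomial (Fin r) K}, p ∈ polyGrading K d a →
    t ∈ piece n e → p • t ∈ piece n (e + a)
  diff_mem : ∀ {n e t}, t ∈ piece n e → diff t ∈ piece (n - 1) e
  diff_diff : ∀ t, diff (diff t) = 0
  diff_mem_filt : ∀ {k t}, t ∈ filt k → diff t ∈ filt k
  filt_zero : filt 0 = ⊥
  filt_mono : Monotone filt
  X_smul_mem_filt : ∀ (j : Fin r) (t : T), (X j : MvPolynomial (Fin r) K) • t ∈ filt (j + 1)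
  mem_filt_of_X_smul_mem : ∀ (j : Fin r) (t : T),
    (X j : MvPolynomial (Fin r) K) • t ∈ filt j → t ∈ filt j
  exists_of_mem_filt : ∀ (j : Fin r) {n e t}, t ∈ piece n e → t ∈ filt (j + 1) →
    ∃ w ∈ piece n (e - d j), t - (X j : MvPolynomial (Fin r) K) • w ∈ filt j

/-- The sum `d₁ + ⋯ + d_m`, where `d_j` is read as `0` for `j > r`. -/
def partialSum (m : ℕ) : ℤ :=
  ∑ j ∈ Finset.univ.filter (fun j : Fin r => (j : ℕ) < m), (d j : ℤ)

theorem partialSum_mono : Monotone (partialSum d) := fun _ _ hab =>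
  Finset.sum_le_sum_of_subset_of_nonneg
    (Finset.monotone_filter_right _ fun _ _ h => lt_of_lt_of_le h hab)
    fun _ _ _ => Int.natCast_nonneg _

theorem partialSum_zero : partialSum d 0 = 0 := by simp [partialSum]

theorem partialSum_succ (j : Fin r) : partialSum d (j + 1) = partialSum d j + d j := by
  have : Finset.univ.filter (fun i : Fin r => (i : ℕ) < (j : ℕ) + 1) =
      insert j (Finset.univ.filter (fun i : Fin r => (i : ℕ) < (j : ℕ))) := by
    ext i
    simp only [Finset.mem_filter, Finset.mem_univ, true_and, Finset.mem_insert, Fin.ext_iff]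
    omega
  rw [partialSum, this, Finset.sum_insert (by simp), add_comm, partialSum]

variable {d} {T : Type w} [AddCommGroup T] [Module (MvPolynomial (Fin r) K) T]

namespace BigradedComplex

/-- The homology of the complex `T / (x₁, …, x_k) T` vanishes in homological degree `n` and
internal degree `e`. -/
def HomologyVanishes (C : BigradedComplex K d T) (k : ℕ) (n e : ℤ) : Prop :=
  ∀ t ∈ C.piece n e, C.diff t ∈ C.filt k → ∃ v ∈ C.piece (n + 1) e, t - C.diff v ∈ C.filt k

variable (C : BigradedComplex K d T)

/-- This is the segment H_n(T_j) → H_n(T_{j+1}) → H_{n-1}(T_j)(-d_j) of the long exact sequence for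
multiplication by the next variable, where T_j = T/(x₁, …, x_j)T. The connecting map sends t to the
w with dt ≡ x w; if w bounds v, then t - x v is a cycle one stage earlier. -/
theorem HomologyVanishes.succ {j : Fin r} {n e : ℤ} (h1 : C.HomologyVanishes j n e)
    (h2 : C.HomologyVanishes j (n - 1) (e - d j)) : C.HomologyVanishes (j + 1) n e := by
  intro t ht hdt
  obtain ⟨w, hw, hu⟩ := C.exists_of_mem_filt j (C.diff_mem ht) hdt
  have hdw : C.diff w ∈ C.filt j := by
    refine C.mem_filt_of_X_smul_mem j _ ?_
    have := C.diff_mem_filt hu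
    rw [map_sub, C.diff_diff, zero_sub, neg_mem_iff, map_smul] at this
    exact this
  obtain ⟨v, hv, hwv⟩ := h2 w hw hdw
  rw [sub_add_cancel] at hv
  have hXv : (X j : MvPolynomial (Fin r) K) • v ∈ C.piece n e := by
    have := C.smul_mem (isWeightedHomogeneous_X K _ j) hv
    rwa [sub_add_cancel] at this
  obtain ⟨v', hv', htv⟩ := h1 (t - (X j : MvPolynomial (Fin r) K) • v) (sub_mem ht hXv) (by
    have : C.diff (t - (X j : MvPolynomial (Fin r) K) • v) =
        (C.diff t - (X j : MvPolynomial (Fin r) K) • w) +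
          (X j : MvPolynomial (Fin r) K) • (w - C.diff v) := by
      rw [map_sub, map_smul, smul_sub]; abel
    rw [this]
    exact add_mem hu (Submodule.smul_mem _ _ hwv))
  refine ⟨v', hv', ?_⟩
  have : t - C.diff v' = (t - (X j : MvPolynomial (Fin r) K) • v - C.diff v') +
      (X j : MvPolynomial (Fin r) K) • v := by abel
  rw [this]
  exact add_mem (C.filt_mono (Nat.le_succ _) htv) (C.X_smul_mem_filt j v)

theorem homologyVanishes_of_neg {k : ℕ} {n e : ℤ} (hn : n < 0) : C.HomologyVanishes k n e := by
  intro t ht _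
  refine ⟨0, zero_mem _, ?_⟩
  rw [C.eq_zero_of_neg hn ht, map_zero, sub_zero]
  exact zero_mem _

/-- Each connecting map lowers the homological degree by one and uses one new variable, so at most
min(n, k) shifts accumulate. -/
theorem homologyVanishes_of_le (hd : Antitone d) {B : ℤ}
    (h0 : ∀ (n : ℕ) (e : ℤ), B < e ∨ n ≠ 0 → C.HomologyVanishes 0 n e)
    {k : ℕ} (hk : k ≤ r) (n : ℕ) (e : ℤ) (he : B + partialSum d (min n k) < e) :
    C.HomologyVanishes k n e := by
  induction k generalizing n e with
  | zero =>
    rw [Nat.min_zero, partialSum_zero, add_zero] at he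
    exact h0 n e (Or.inl he)
  | succ k ih =>
    set j : Fin r := ⟨k, hk⟩
    refine HomologyVanishes.succ C (j := j) (ih (by omega) n e (lt_of_le_of_lt ?_ he)) ?_
    · exact add_le_add_right (partialSum_mono d (by omega)) _
    · rcases n with _ | n
      · exact C.homologyVanishes_of_neg (by simp)
      · rw [Nat.cast_succ, add_sub_cancel_right]
        refine ih (by omega) n _ ?_
        rw [← add_lt_add_iff_right (d j : ℤ), sub_add_cancel, add_assoc]
        refine lt_of_le_of_lt (add_le_add_right ?_ _) he
        -- Either the new variable contributes the next summand itself, or the sum already stops at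
        -- n + 1 terms and monotonicity of d bounds the new weight by the last of them.
        rcases le_total k n with hkn | hkn
        · rw [min_eq_right hkn, min_eq_right (by omega)]
          exact (partialSum_succ d j).ge
        · rw [min_eq_left hkn, min_eq_left (by omega)]
          have := partialSum_succ d ⟨n, by omega⟩
          have hle : d j ≤ d ⟨n, by omega⟩ := hd hkn
          simp only at this
          rw [this]
          exact add_le_add_right (by exact_mod_cast hle) _

/-- The cone of the multiplication with a homogeneous element `f` of degree `a`. -/
def cone {f : MvPolynomial (Fin r) K} {a : ℤ} (hf : f ∈ polyGrading K d a) :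
    BigradedComplex K d (T × T) where
  piece n e := (C.piece n e).prod (C.piece (n - 1) (e - a))
  diff := ((C.diff ∘ₗ LinearMap.fst _ _ _) + f • LinearMap.snd _ _ _).prod
    (-(C.diff ∘ₗ LinearMap.snd _ _ _))
  filt k := (C.filt k).prod (C.filt k)
  eq_zero_of_neg := fun hn ht => Prod.ext (C.eq_zero_of_neg hn ht.1)
    (C.eq_zero_of_neg (by omega) ht.2)
  smul_mem := fun {b n e t p} hp ht => ⟨C.smul_mem hp ht.1, by
    have := C.smul_mem hp ht.2
    rwa [sub_add_eq_add_sub] at this⟩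
  diff_mem := fun {n e t} ht => ⟨add_mem (C.diff_mem ht.1) (by
    have := C.smul_mem hf ht.2
    rwa [sub_add_cancel] at this), neg_mem (C.diff_mem ht.2)⟩
  diff_diff t := by
    refine Prod.ext ?_ ?_ <;> simp [C.diff_diff]
  diff_mem_filt := fun ht => ⟨add_mem (C.diff_mem_filt ht.1) (Submodule.smul_mem _ _ ht.2),
    neg_mem (C.diff_mem_filt ht.2)⟩
  filt_zero := by rw [C.filt_zero, Submodule.prod_bot]
  filt_mono := fun i j hij => Submodule.prod_mono (C.filt_mono hij) (C.filt_mono hij)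
  X_smul_mem_filt j t := ⟨C.X_smul_mem_filt j _, C.X_smul_mem_filt j _⟩
  mem_filt_of_X_smul_mem j t ht := ⟨C.mem_filt_of_X_smul_mem j _ ht.1,
    C.mem_filt_of_X_smul_mem j _ ht.2⟩
  exists_of_mem_filt := fun j {n e t} ht ht' => by
    obtain ⟨w, hw, hu⟩ := C.exists_of_mem_filt j ht.1 ht'.1
    obtain ⟨w', hw', hu'⟩ := C.exists_of_mem_filt j ht.2 ht'.2
    exact ⟨(w, w'), ⟨hw, by rwa [sub_right_comm]⟩, hu, hu'⟩

theorem cone_diff_apply {f : MvPolynomial (Fin r) K} {a : ℤ} (hf : f ∈ polyGrading K d a)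
    (x y : T) : (C.cone hf).diff (x, y) = (C.diff x + f • y, -C.diff y) := rfl

theorem smul_mem_filt {f : MvPolynomial (Fin r) K} (hf : f ∈ idealOfVars (Fin r) K) (t : T) :
    f • t ∈ C.filt r := by
  rw [idealOfVars] at hf
  induction hf using Submodule.span_induction with
  | mem x hx =>
    obtain ⟨j, rfl⟩ := hx
    exact C.filt_mono (Nat.succ_le_of_lt j.2) (C.X_smul_mem_filt j t)
  | zero => rw [zero_smul]; exact zero_mem _
  | add x y _ _ hx hy => rw [add_smul]; exact add_mem hx hy
  | smul p x _ hx => rw [smul_assoc]; exact Submodule.smul_mem _ _ hx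

/-- Modulo the variables f acts as zero, so a cycle t of the complex gives the cycle (0, t) of the
cone, and the second coordinate of a bounding element bounds t up to sign. -/
theorem HomologyVanishes.of_cone {f : MvPolynomial (Fin r) K} {a : ℤ} (hf : f ∈ polyGrading K d a)
    (hf' : f ∈ idealOfVars (Fin r) K) {n e : ℤ}
    (h : (C.cone hf).HomologyVanishes r (n + 1) (e + a)) : C.HomologyVanishes r n e := by
  intro t ht hdt
  obtain ⟨⟨v, v'⟩, hv, hv'⟩ := h (0, t)
    ⟨zero_mem _, by rwa [add_sub_cancel_right, add_sub_cancel_right]⟩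
    ⟨add_mem (by rw [LinearMap.comp_apply, LinearMap.fst_apply, map_zero]; exact zero_mem _)
      (C.smul_mem_filt hf' _), neg_mem hdt⟩
  have h2 : v' ∈ C.piece (n + 1 + 1 - 1) (e + a - a) := hv.2
  rw [add_sub_cancel_right, add_sub_cancel_right] at h2
  refine ⟨-v', neg_mem h2, ?_⟩
  rw [map_neg]
  exact hv'.2

/-- The complex is a resolution of the graded module `M`. -/
structure Resolves {M : Type v} [AddCommGroup M] [Module K M] [Module (MvPolynomial (Fin r) K) M]
    (π : ℤ → M →ₗ[K] M) (aug : T →ₗ[MvPolynomial (Fin r) K] M) : Prop where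
  aug_mem : ∀ {e t}, t ∈ C.piece 0 e → π e (aug t) = aug t
  exists_aug_eq : ∀ {e m}, π e m = m → ∃ t ∈ C.piece 0 e, aug t = m
  aug_diff : ∀ {e t}, t ∈ C.piece 1 e → aug (C.diff t) = 0
  exists_diff_eq_of_aug : ∀ {e t}, t ∈ C.piece 0 e → aug t = 0 → ∃ v ∈ C.piece 1 e, C.diff v = t
  exists_diff_eq : ∀ {n e t}, 0 < n → t ∈ C.piece n e → C.diff t = 0 →
    ∃ v ∈ C.piece (n + 1) e, C.diff v = t

variable {C} {M : Type v} [AddCommGroup M] [Module K M] [Module (MvPolynomial (Fin r) K) M]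
    {π : ℤ → M →ₗ[K] M} {aug : T →ₗ[MvPolynomial (Fin r) K] M}

/-- The homology of the cone is the kernel and cokernel of f on M, and the kernel is zero. -/
theorem Resolves.cone [IsScalarTower K (MvPolynomial (Fin r) K) M] (h : C.Resolves π aug)
    (hπ : IsGrading d π)
    {f : MvPolynomial (Fin r) K} {a : ℤ} (hf : f ∈ polyGrading K d a) (hreg : IsSMulRegular M f) :
    (C.cone hf).Resolves (quotientProj hπ hf)
      ((f • (⊤ : Submodule (MvPolynomial (Fin r) K) M)).mkQ ∘ₗ aug ∘ₗ LinearMap.fst _ _ _) where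
  aug_mem := fun {e t} ht => by
    rw [LinearMap.comp_apply, Submodule.mkQ_apply, quotientProj_mk]
    exact congrArg _ (h.aug_mem ht.1)
  exists_aug_eq := fun {e m} hm => by
    obtain ⟨m, rfl⟩ := Submodule.Quotient.mk_surjective _ m
    rw [quotientProj_mk] at hm
    obtain ⟨t, ht, htm⟩ := h.exists_aug_eq (hπ.idem e m)
    refine ⟨(t, 0), ⟨ht, zero_mem _⟩, ?_⟩
    rw [← hm, ← htm]
    rfl
  aug_diff := fun {e t} ht => by
    have h1 := h.aug_diff ht.1
    refine (Submodule.Quotient.mk_eq_zero _).mpr ?_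
    change aug (C.diff t.1 + f • t.2) ∈ _
    rw [map_add, h1, zero_add, map_smul]
    exact Submodule.smul_mem_pointwise_smul _ _ _ trivial
  exists_diff_eq_of_aug := fun {e t} ht h0 => by
    obtain ⟨x, y⟩ := t
    have hy : y = 0 := C.eq_zero_of_neg (by omega) ht.2
    have hx : x ∈ C.piece 0 e := ht.1
    subst hy
    obtain ⟨m, -, hm⟩ := (Submodule.mem_smul_pointwise_iff_exists _ _ _).mp
      ((Submodule.Quotient.mk_eq_zero _).mp h0)
    have hm : f • m = aug x := hm
    -- Regularity makes m homogeneous: f m and f π(m) agree, since aug x has degree e.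
    have hm' : π (e - a) m = m := by
      refine hreg ?_
      change f • π (e - a) m = f • m
      rw [← hπ.smul' hf, hm, h.aug_mem hx]
    obtain ⟨b, hb, rfl⟩ := h.exists_aug_eq hm'
    have hfb : f • b ∈ C.piece 0 e := by
      have := C.smul_mem hf hb
      rwa [sub_add_cancel] at this
    obtain ⟨v, hv, hdv⟩ := h.exists_diff_eq_of_aug (sub_mem hx hfb) (by
      rw [map_sub, map_smul, hm, sub_self])
    refine ⟨(v, b), ⟨hv, by rwa [sub_self]⟩, ?_⟩
    have hdb : C.diff b = 0 := C.eq_zero_of_neg (by omega) (C.diff_mem hb)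
    rw [C.cone_diff_apply, hdv, hdb, sub_add_cancel, neg_zero]
  exists_diff_eq := fun {n e t} hn ht h0 => by
    obtain ⟨x, y⟩ := t
    have hx : x ∈ C.piece n e := ht.1
    have hy : y ∈ C.piece (n - 1) (e - a) := ht.2
    rw [C.cone_diff_apply, Prod.mk_eq_zero, neg_eq_zero] at h0
    -- For n = 1 the element y lies in homological degree 0, where it is a boundary only if its
    -- augmentation vanishes; this is where regularity of f enters.
    obtain ⟨b, hb, hdb⟩ : ∃ b ∈ C.piece n (e - a), C.diff b = y := by
      rcases (show n = 1 ∨ 0 < n - 1 by omega) with rfl | hn1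
      · rw [sub_self] at hy
        refine h.exists_diff_eq_of_aug hy (hreg.right_eq_zero_of_smul ?_)
        have := congrArg aug h0.1
        rwa [map_add, map_smul, h.aug_diff hx, zero_add, map_zero] at this
      · have := h.exists_diff_eq hn1 hy h0.2
        rwa [sub_add_cancel] at this
    have hfb : f • b ∈ C.piece n e := by
      have := C.smul_mem hf hb
      rwa [sub_add_cancel] at this
    obtain ⟨v, hv, hdv⟩ := h.exists_diff_eq hn (add_mem hx hfb) (by
      rw [map_add, map_smul, hdb, h0.1])
    refine ⟨(v, -b), ⟨hv, ?_⟩, ?_⟩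
    · rw [add_sub_cancel_right]
      exact (C.piece n (e - a)).neg_mem hb
    · rw [C.cone_diff_apply, hdv, map_neg, neg_neg, hdb, smul_neg, add_neg_cancel_right]

theorem Resolves.homologyVanishes (h : C.Resolves π aug) (hd : Antitone d) {B : ℤ}
    (hB : ∀ e > B, ∀ m, π e m = 0) (n : ℕ) (e : ℤ) (he : B + partialSum d n < e) :
    C.HomologyVanishes r n e := by
  refine C.homologyVanishes_of_le hd (B := B) (fun n e hne t ht hdt => ?_) le_rfl n e
    (lt_of_le_of_lt (add_le_add_right (partialSum_mono d (min_le_left _ _)) _) he)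
  rw [C.filt_zero, Submodule.mem_bot] at hdt
  rcases Nat.eq_zero_or_pos n with rfl | hn
  · have he : B < e := by simpa using hne
    obtain ⟨v, hv, hdv⟩ := h.exists_diff_eq_of_aug ht (by
      rw [← h.aug_mem ht]
      exact hB e he _)
    exact ⟨v, by simpa using hv, by rw [hdv, sub_self]; exact zero_mem _⟩
  · obtain ⟨v, hv, hdv⟩ := h.exists_diff_eq (by exact_mod_cast hn) ht hdt
    exact ⟨v, hv, by rw [hdv, sub_self]; exact zero_mem _⟩

end BigradedComplex

end Complex

end SyzygyBound

end

/-! ### Hilbert series as rational functions. -/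

noncomputable section

namespace SyzygyBound

open Pointwise

theorem exists_ratFunc_of_finite {h : ℤ → ℚ} (I : Finset ℤ) (hI : ∀ e ∉ I, h e = 0) :
    ∃ H : RatFunc ℚ, (∀ e, (H : LaurentSeries ℚ).coeff e = h e) ∧
      ∀ e, h e ≠ 0 → H ≠ 0 ∧ e ≤ H.intDegree := by
  -- Multiplication by X^N clears the negative exponents.
  obtain ⟨N, hN⟩ : ∃ N : ℕ, ∀ e ∈ I, 0 ≤ e + N := by
    obtain ⟨b, hb⟩ := I.bddBelow
    exact ⟨b.natAbs, fun e he => by have := hb (Finset.mem_coe.mpr he); omega⟩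
  let p : Polynomial ℚ := ∑ e ∈ I, Polynomial.monomial (e + N).toNat (h e)
  have hp : ∀ n : ℕ, p.coeff n = h (n - N) := by
    intro n
    simp only [p, Polynomial.finsetSum_coeff, Polynomial.coeff_monomial]
    by_cases hn : (n : ℤ) - N ∈ I
    · rw [Finset.sum_eq_single_of_mem _ hn, if_pos (by simp)]
      intro e he hne
      have := hN e he
      exact if_neg (by omega)
    · rw [hI _ hn]
      refine Finset.sum_eq_zero fun e he => if_neg fun heq => hn ?_
      have := hN e he
      convert he using 1
      omega
  have hXN : ((RatFunc.X : RatFunc ℚ) ^ N) ≠ 0 := pow_ne_zero _ RatFunc.X_ne_zero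
  have hcoe : ∀ n : ℤ, ((p : RatFunc ℚ) : LaurentSeries ℚ).coeff n = h (n - N) := by
    intro n
    rw [← RatFunc.coe_coe, PowerSeries.coeff_coe]
    split_ifs with hn
    · refine (hI _ fun hmem => ?_).symm
      have := hN _ hmem
      omega
    · rw [Polynomial.coeff_coe, hp]
      congr 2
      omega
  let H : RatFunc ℚ := (p : RatFunc ℚ) / RatFunc.X ^ N
  have hH : H * RatFunc.X ^ N = (p : RatFunc ℚ) := div_mul_cancel₀ _ hXN
  have hcoeff : ∀ e, (H : LaurentSeries ℚ).coeff e = h e := by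
    intro e
    have h1 := hcoe (e + N)
    rw [← hH, map_mul, map_pow, RatFunc.coe_X, HahnSeries.single_pow, one_pow,
      HahnSeries.coeff_mul_single, mul_one] at h1
    simpa using h1
  refine ⟨H, hcoeff, fun e he => ?_⟩
  have heN : 0 ≤ e + N := hN e (by_contra fun hne => he (hI e hne))
  have hpe : p.coeff (e + N).toNat ≠ 0 := by
    rw [hp]
    convert he using 2
    omega
  have hp0 : p ≠ 0 := fun h0 => hpe (by rw [h0, Polynomial.coeff_zero])
  have hp0' : (p : RatFunc ℚ) ≠ 0 := by
    change algebraMap (Polynomial ℚ) (RatFunc ℚ) p ≠ 0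
    exact RatFunc.algebraMap_ne_zero hp0
  refine ⟨div_ne_zero hp0' hXN, ?_⟩
  have hdeg : (p : RatFunc ℚ).intDegree = p.natDegree := RatFunc.intDegree_polynomial
  have hdegX : ((RatFunc.X : RatFunc ℚ) ^ N).intDegree = N := by
    rw [← RatFunc.algebraMap_X, ← map_pow, RatFunc.intDegree_polynomial, Polynomial.natDegree_X_pow]
  rw [RatFunc.intDegree_div hp0' hXN, hdeg, hdegX]
  have := Polynomial.le_natDegree_of_ne_zero hpe
  omega

theorem intDegree_one_sub_X_pow {a : ℕ} (ha : 0 < a) :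
    (1 - RatFunc.X ^ a : RatFunc ℚ) ≠ 0 ∧ (1 - RatFunc.X ^ a : RatFunc ℚ).intDegree = a := by
  have hmap : (1 - RatFunc.X ^ a : RatFunc ℚ) =
      -algebraMap (Polynomial ℚ) (RatFunc ℚ) (Polynomial.X ^ a - Polynomial.C 1) := by
    rw [map_sub, map_pow, RatFunc.algebraMap_X, Polynomial.C_1, map_one, neg_sub]
  rw [hmap]
  refine ⟨neg_ne_zero.mpr (RatFunc.algebraMap_ne_zero (Polynomial.X_pow_sub_C_ne_zero ha _)), ?_⟩
  rw [RatFunc.intDegree_neg, RatFunc.intDegree_polynomial, Polynomial.natDegree_X_pow_sub_C]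

/-- Both coefficient families vanish far to the left and satisfy the same recursion with positive
step a, hence coincide. -/
theorem coeff_eq_of_sub_eq {a : ℕ} (ha : 0 < a) {h : ℤ → ℚ} {b : ℤ} (hb : ∀ e < b, h e = 0)
    {H' : RatFunc ℚ} (hH' : ∀ e, (H' : LaurentSeries ℚ).coeff e = h e - h (e - a)) (e : ℤ) :
    ((H' / (1 - RatFunc.X ^ a) : RatFunc ℚ) : LaurentSeries ℚ).coeff e = h e := by
  set H : RatFunc ℚ := H' / (1 - RatFunc.X ^ a)
  have hrec : ∀ e, (H : LaurentSeries ℚ).coeff e - (H : LaurentSeries ℚ).coeff (e - a) =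
      h e - h (e - a) := by
    intro e
    have hmul : H * (1 - RatFunc.X ^ a) = H' := div_mul_cancel₀ _ (intDegree_one_sub_X_pow ha).1
    rw [← hH', ← hmul, map_mul, map_sub, map_one, map_pow, RatFunc.coe_X, HahnSeries.single_pow,
      one_pow, mul_sub, mul_one, HahnSeries.coeff_sub, HahnSeries.coeff_mul_single, mul_one]
    simp
  obtain ⟨b', hb'⟩ : ∃ b' : ℤ, ∀ e < b', (H : LaurentSeries ℚ).coeff e = 0 :=
    ⟨(H : LaurentSeries ℚ).order, fun e he => HahnSeries.coeff_eq_zero_of_lt_order he⟩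
  have key : ∀ (n : ℕ) (e : ℤ), e < min b b' + n → (H : LaurentSeries ℚ).coeff e = h e := by
    intro n
    induction n with
    | zero =>
      intro e he
      rw [hb e (by omega), hb' e (by omega)]
    | succ n ih =>
      intro e he
      have h1 := ih (e - a) (by push_cast at he; omega)
      have h2 := hrec e
      rw [h1] at h2
      linarith
  exact key (e - min b b' + 1).toNat e (by omega)

variable {K : Type u} [Field K] {r : ℕ} {d : Fin r → ℕ}
  {M : Type v} [AddCommGroup M] [Module K M] [Module (MvPolynomial (Fin r) K) M]
  {π : ℤ → M →ₗ[K] M}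

theorem IsGrading.mem_range_iff (h : IsGrading d π) {e : ℤ} {m : M} :
    m ∈ LinearMap.range (π e) ↔ π e m = m :=
  ⟨by rintro ⟨x, rfl⟩; exact h.idem e x, fun hm => ⟨m, hm⟩⟩

/-- Dimension count in the exact sequence 0 → M_{e-a} → M_e → (M/fM)_e → 0, the first map being
multiplication by f. -/
theorem IsGrading.finrank_range [IsScalarTower K (MvPolynomial (Fin r) K) M] (h : IsGrading d π)
    {f : MvPolynomial (Fin r) K} {a : ℤ}
    (hf : f ∈ polyGrading K d a) (hreg : IsSMulRegular M f) (e : ℤ)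
    [Module.Finite K (LinearMap.range (π (e - a)))]
    [Module.Finite K (LinearMap.range (quotientProj h hf e))] :
    Module.Finite K (LinearMap.range (π e)) ∧
    Module.finrank K (LinearMap.range (π e)) = Module.finrank K (LinearMap.range (π (e - a))) +
      Module.finrank K (LinearMap.range (quotientProj h hf e)) := by
  let i : LinearMap.range (π (e - a)) →ₗ[K] LinearMap.range (π e) :=
    (((LinearMap.lsmul (MvPolynomial (Fin r) K) M f).restrictScalars K) ∘ₗ
      Submodule.subtype _).codRestrict _ fun m => h.mem_range_iff.mpr (by
        have := h.mem_range_iff.mp m.2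
        change π e (f • (m : M)) = f • (m : M)
        rw [h.smul' hf, this])
  let g : LinearMap.range (π e) →ₗ[K] LinearMap.range (quotientProj h hf e) :=
    (((f • (⊤ : Submodule (MvPolynomial (Fin r) K) M)).mkQ.restrictScalars K) ∘ₗ
      Submodule.subtype _).codRestrict _ fun m =>
        (isGrading_quotientProj h hf).mem_range_iff.mpr (by
          have := h.mem_range_iff.mp m.2
          change quotientProj h hf e (Submodule.Quotient.mk (m : M)) = Submodule.Quotient.mk (m : M)
          rw [quotientProj_mk, this])
  have hi : Function.Injective i := fun x y hxy =>
    Subtype.ext (hreg (congrArg Subtype.val hxy))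
  have hg : Function.Surjective g := by
    rintro ⟨_, y, rfl⟩
    obtain ⟨m, rfl⟩ := Submodule.Quotient.mk_surjective _ y
    exact ⟨⟨π e m, m, rfl⟩, Subtype.ext (quotientProj_mk h hf e m).symm⟩
  have hig : LinearMap.range i = LinearMap.ker g := by
    ext ⟨x, hx⟩
    rw [h.mem_range_iff] at hx
    constructor
    · rintro ⟨y, hy⟩
      refine LinearMap.mem_ker.mpr (Subtype.ext ((Submodule.Quotient.mk_eq_zero _).mpr ?_))
      rw [← hy]
      exact Submodule.smul_mem_pointwise_smul _ _ _ trivial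
    · intro hy
      obtain ⟨m, -, hm⟩ := (Submodule.mem_smul_pointwise_iff_exists _ _ _).mp
        ((Submodule.Quotient.mk_eq_zero _).mp (congrArg Subtype.val (LinearMap.mem_ker.mp hy)))
      have hm : f • m = x := hm
      refine ⟨⟨π (e - a) m, m, rfl⟩, Subtype.ext ?_⟩
      change f • π (e - a) m = x
      rw [← h.smul' hf, hm, hx]
  have hker : Module.Finite K (LinearMap.ker g) := hig ▸ Module.Finite.range i
  have hfin : Module.Finite K (LinearMap.range (π e)) := by
    have : Module.Finite K (LinearMap.range (π e) ⧸ LinearMap.ker g) :=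
      Module.Finite.equiv (g.quotKerEquivOfSurjective hg).symm
    exact Module.Finite.of_submodule_quotient (LinearMap.ker g)
  refine ⟨hfin, ?_⟩
  rw [← LinearMap.finrank_range_add_finrank_ker g, LinearMap.range_eq_top.mpr hg, finrank_top,
    ← hig, LinearMap.finrank_range_of_inj hi, add_comm]

/-- Induction upwards from a degree below which M vanishes, by the same exact sequence. -/
theorem IsGrading.finite_range [IsScalarTower K (MvPolynomial (Fin r) K) M]
    [Module.Finite (MvPolynomial (Fin r) K) M] (h : IsGrading d π)
    {f : MvPolynomial (Fin r) K} {a : ℕ} (ha : 0 < a)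
    (hf : f ∈ polyGrading K d a) (hreg : IsSMulRegular M f)
    (hfin : ∀ e, Module.Finite K (LinearMap.range (quotientProj h hf e))) (e : ℤ) :
    Module.Finite K (LinearMap.range (π e)) := by
  obtain ⟨b, hb⟩ := h.exists_lower_bound
  have key : ∀ (n : ℕ) (e : ℤ), e < b + n → Module.Finite K (LinearMap.range (π e)) := by
    intro n
    induction n with
    | zero =>
      intro e he
      have : π e = 0 := LinearMap.ext (hb e (by simpa using he))
      rw [this, LinearMap.range_zero]
      infer_instance
    | succ n ih =>
      intro e he
      have := ih (e - a) (by push_cast at he; omega)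
      have := hfin e
      exact (h.finrank_range hf hreg e).1
  exact key (e - b + 1).toNat e (by omega)

theorem IsGrading.isHilbertSeries_div [IsScalarTower K (MvPolynomial (Fin r) K) M]
    [Module.Finite (MvPolynomial (Fin r) K) M] (h : IsGrading d π)
    {f : MvPolynomial (Fin r) K} {a : ℕ} (ha : 0 < a)
    (hf : f ∈ polyGrading K d a) (hreg : IsSMulRegular M f) {H : RatFunc ℚ}
    (hH : IsHilbertSeries (fun e => LinearMap.range (quotientProj h hf e)) H) :
    IsHilbertSeries (fun e => LinearMap.range (π e)) (H / (1 - RatFunc.X ^ a)) := by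
  have hfin := h.finite_range ha hf hreg fun e => (hH e).1
  refine fun e => ⟨hfin e, ?_⟩
  obtain ⟨b, hb⟩ := h.exists_lower_bound
  refine coeff_eq_of_sub_eq (h := fun e => (Module.finrank K (LinearMap.range (π e)) : ℚ)) ha
    (b := b) (fun e he => ?_) (fun e => ?_) e
  · have : π e = 0 := LinearMap.ext (hb e he)
    simp [this]
  · have := hfin (e - a)
    have := (hH e).1
    rw [(hH e).2, (h.finrank_range hf hreg e).2]
    push_cast
    ring

theorem IsGrading.exists_isHilbertSeries_of_finite [Module.Finite K M] (h : IsGrading d π) :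
    ∃ H : RatFunc ℚ, IsHilbertSeries (fun e => LinearMap.range (π e)) H ∧
      ∀ e, LinearMap.range (π e) ≠ ⊥ → H ≠ 0 ∧ e ≤ H.intDegree := by
  obtain ⟨I, hI⟩ := h.exists_upper_bound
  obtain ⟨H, hH, hdeg⟩ := exists_ratFunc_of_finite
    (h := fun e => (Module.finrank K (LinearMap.range (π e)) : ℚ)) I fun e he => by
      have : π e = 0 := LinearMap.ext (hI e he)
      simp [this]
  exact ⟨H, fun e => ⟨inferInstance, hH e⟩, fun e he => hdeg e (Nat.cast_ne_zero.mpr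
    fun h0 => he (Submodule.finrank_eq_zero.mp h0))⟩

end SyzygyBound

end

/-! ### The induction on the dimension. -/

noncomputable section

namespace SyzygyBound

open Pointwise IsLocalRing MvPolynomial

theorem le_of_add_one_le {x : WithBot ℕ∞} {n : ℕ} (h : x + 1 ≤ ((n + 1 : ℕ) : ℕ∞)) :
    x ≤ (n : ℕ∞) := by
  cases x with
  | bot => exact bot_le
  | coe x =>
    have hx : x + 1 ≤ (n : ℕ∞) + 1 := by exact_mod_cast h
    exact_mod_cast (ENat.add_le_add_iff_right ENat.one_ne_top).mp hx

/-- All complexes resolving M are treated at once, because the inductive step replaces the given one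
by a cone, which need not come from a chosen resolution of the quotient. The clause `H ≠ 0 →`
demands vanishing in every degree when M = 0. -/
theorem exists_hilbertSeries_and_bound {K : Type u} [Field K] {r : ℕ} {d : Fin r → ℕ}
    (hd_pos : ∀ j, 0 < d j) (hd : Antitone d) (n : ℕ)
    {M : Type v} [AddCommGroup M] [Module K M] [Module (MvPolynomial (Fin r) K) M]
    [IsScalarTower K (MvPolynomial (Fin r) K) M] [Module.Finite (MvPolynomial (Fin r) K) M]
    {π : ℤ → M →ₗ[K] M} (h : IsGrading d π)
    (hdim : Module.supportDim (Localization.AtPrime (idealOfVars (Fin r) K))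
      (LocalizedModule (idealOfVars (Fin r) K).primeCompl M) ≤ (n : ℕ∞))
    (hreg : n = 0 ∨ ∃ rs : List (Localization.AtPrime (idealOfVars (Fin r) K)),
      rs.length = n ∧ (∀ x ∈ rs, x ∈ maximalIdeal _) ∧ RingTheory.Sequence.IsRegular
        (LocalizedModule (idealOfVars (Fin r) K).primeCompl M) rs) :
    ∃ H : RatFunc ℚ, IsHilbertSeries (fun e => LinearMap.range (π e)) H ∧
      ∀ {T : Type w} [AddCommGroup T] [Module (MvPolynomial (Fin r) K) T]
        {C : BigradedComplex K d T} {aug : T →ₗ[MvPolynomial (Fin r) K] M}, C.Resolves π aug →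
        ∀ (i : ℕ) (e : ℤ), (H ≠ 0 → H.intDegree + partialSum d (n + i) < e) →
          C.HomologyVanishes r i e := by
  induction n generalizing M with
  | zero =>
    have := h.finite_of_supportDim_le_zero hd_pos (by simpa using hdim)
    obtain ⟨H, hH, hdeg⟩ := h.exists_isHilbertSeries_of_finite
    refine ⟨H, hH, fun {T} _ _ C aug hC i e he => ?_⟩
    rw [zero_add] at he
    have hzero : ∀ e, (H ≠ 0 → H.intDegree < e) → ∀ m, π e m = 0 := by
      intro e he m
      by_contra hne
      obtain ⟨h0, hle⟩ := hdeg e fun hbot => hne <| by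
        have : π e m ∈ LinearMap.range (π e) := ⟨m, rfl⟩
        rwa [hbot] at this
      exact absurd (he h0) (not_lt.mpr hle)
    by_cases h0 : H = 0
    -- Here every piece of M is zero, so any B is admissible; this one puts e just above the bound.
    · exact hC.homologyVanishes hd (B := e - partialSum d i - 1)
        (fun e _ => hzero e fun hne => absurd h0 hne) i e (by omega)
    · exact hC.homologyVanishes hd (fun e hlt => hzero e fun _ => hlt) i e (he h0)
  | succ n ih =>
    have hreg := hreg.resolve_left (Nat.succ_ne_zero n)
    have hass : idealOfVars (Fin r) K ∉ associatedPrimes (MvPolynomial (Fin r) K) M := by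
      obtain ⟨rs, hlen, hmem, hrs⟩ := hreg
      exact idealOfVars_notMem_associatedPrimes (List.ne_nil_of_length_eq_add_one hlen) hmem hrs
    obtain ⟨a, ha, f, hf, hfreg⟩ := exists_homogeneous_isSMulRegular hd_pos hass
    have hfm : f ∈ idealOfVars (Fin r) K :=
      mem_idealOfVars_iff.mpr (constantCoeff_eq_zero_of_mem hf (by exact_mod_cast ha.ne'))
    set f' := algebraMap _ (Localization.AtPrime (idealOfVars (Fin r) K)) f
    have hf'm : f' ∈ maximalIdeal (Localization.AtPrime (idealOfVars (Fin r) K)) :=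
      (IsLocalization.AtPrime.to_map_mem_maximal_iff _ (idealOfVars (Fin r) K) f).mpr hfm
    have hf'reg : IsSMulRegular (LocalizedModule (idealOfVars (Fin r) K).primeCompl M) f' :=
      IsSMulRegular.of_isLocalizedModule _ (idealOfVars (Fin r) K).primeCompl
        (LocalizedModule.mkLinearMap (idealOfVars (Fin r) K).primeCompl M) hfreg
    let ε := localizedQuotSMulTopEquiv (idealOfVars (Fin r) K) M f
    have hdim' : Module.supportDim (Localization.AtPrime (idealOfVars (Fin r) K))
        (LocalizedModule (idealOfVars (Fin r) K).primeCompl (QuotSMulTop f M)) ≤ (n : ℕ∞) := by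
      rw [Module.supportDim_eq_of_equiv ε]
      have := Module.supportDim_quotSMulTop_succ_eq_supportDim hf'reg hf'm
      rw [← this] at hdim
      exact le_of_add_one_le hdim
    obtain ⟨rs, hlen, hmem, hrs⟩ := exists_isRegular_quotSMulTop.{u, v} hreg hf'm hf'reg
    obtain ⟨H, hH, hbound⟩ := ih (isGrading_quotientProj h hf) hdim'
      (Or.inr ⟨rs, hlen, hmem, (ε.isRegular_congr rs).mpr hrs⟩)
    refine ⟨_, h.isHilbertSeries_div ha hf hfreg hH, fun {T} _ _ C aug hC i e he => ?_⟩
    refine BigradedComplex.HomologyVanishes.of_cone C hf hfm ?_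
    -- The partial sum index is unchanged, as n + (i + 1) = (n + 1) + i, and the internal shift a
    -- cancels the degree of 1 - X^a.
    refine hbound (hC.cone h hf hfreg) (i + 1) (e + a) fun h0 => ?_
    obtain ⟨hX, hXdeg⟩ := intDegree_one_sub_X_pow ha
    have := he (div_ne_zero h0 hX)
    rw [RatFunc.intDegree_div h0 hX, hXdeg, add_right_comm n 1 i] at this
    rw [← add_assoc]
    linarith

end SyzygyBound

end

noncomputable section

namespace SyzygyBound

open MvPolynomial Pointwise IsLocalRing

/-! ### Graded free modules and ideals generated by initial variables. -/

section Free

variable {K : Type u} [Field K] {r : ℕ} {d : Fin r → ℕ} {ι : Type w}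

/-- The projection of the graded free module `⨁ⱼ S(-deg j)` onto its piece of degree `e`. -/
def freeProj (d : Fin r → ℕ) (deg : ι → ℤ) (e : ℤ) :
    (ι →₀ MvPolynomial (Fin r) K) →ₗ[K] (ι →₀ MvPolynomial (Fin r) K) :=
  Finsupp.lsum K fun j => Finsupp.lsingle j ∘ₗ
    weightedHomogeneousComponent (fun j => (d j : ℤ)) (e - deg j)

theorem freeProj_single (deg : ι → ℤ) (e : ℤ) (j : ι) (p : MvPolynomial (Fin r) K) :
    freeProj d deg e (Finsupp.single j p) =
      Finsupp.single j (weightedHomogeneousComponent (fun j => (d j : ℤ)) (e - deg j) p) := by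
  simp [freeProj]

theorem freeProj_apply (deg : ι → ℤ) (e : ℤ) (f : ι →₀ MvPolynomial (Fin r) K) (i : ι) :
    freeProj d deg e f i =
      weightedHomogeneousComponent (fun j => (d j : ℤ)) (e - deg i) (f i) := by
  induction f using Finsupp.induction_linear with
  | zero => simp
  | add f g hf hg => rw [map_add, Finsupp.add_apply, hf, hg, Finsupp.add_apply, map_add]
  | single j p =>
    rw [freeProj_single]
    by_cases h : j = i
    · subst h; simp
    · simp [Finsupp.single_eq_of_ne' h]

theorem freeProj_eq_self_iff {deg : ι → ℤ} {e : ℤ} {f : ι →₀ MvPolynomial (Fin r) K} :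
    freeProj d deg e f = f ↔ f ∈ freePiece d deg e := by
  constructor
  · intro h j
    rw [← h, freeProj_apply]
    exact weightedHomogeneousComponent_mem _ _ _
  · intro h
    ext1 j
    rw [freeProj_apply]
    exact weightedHomogeneousComponent_eq_self (h j)

theorem weightedHomogeneousComponent_mul {a : ℤ} {p : MvPolynomial (Fin r) K}
    (hp : p ∈ polyGrading K d a) (b : ℤ) (q : MvPolynomial (Fin r) K) :
    weightedHomogeneousComponent (fun j => (d j : ℤ)) (b + a) (p * q) =
      p * weightedHomogeneousComponent (fun j => (d j : ℤ)) b q := by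
  induction q using MvPolynomial.induction_on' with
  | monomial α c =>
    have hα := monomial_mem_polyGrading (d := d) α c
    rw [weightedHomogeneousComponent_of_mem hα,
      weightedHomogeneousComponent_of_mem (polyGrading_mul_mem hp hα), add_comm b,
      mul_ite, mul_zero]
    simp only [add_right_inj]
  | add q q' hq hq' => rw [mul_add, map_add, hq, hq', map_add, mul_add]

theorem isGrading_freeProj (deg : ι → ℤ) :
    IsGrading d (freeProj (K := K) d deg) where
  idem e f := freeProj_eq_self_iff.mpr fun j => by
    rw [freeProj_apply]
    exact weightedHomogeneousComponent_mem _ _ _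
  orth e e' f hne := by
    ext1 j
    rw [freeProj_apply, freeProj_apply,
      weightedHomogeneousComponent_of_mem (weightedHomogeneousComponent_mem _ _ _),
      if_neg (by omega), Finsupp.zero_apply]
  smul a e p f hp := by
    ext1 j
    rw [freeProj_apply, Finsupp.smul_apply, Finsupp.smul_apply, freeProj_apply, smul_eq_mul,
      smul_eq_mul, ← weightedHomogeneousComponent_mul hp, add_sub_right_comm]
  mem_iSup f := by
    induction f using Finsupp.induction_linear with
    | zero => exact Submodule.zero_mem _
    | add f g hf hg => exact Submodule.add_mem _ hf hg
    | single j p =>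
      induction p using MvPolynomial.induction_on' with
      | monomial α c =>
        refine Submodule.mem_iSup_of_mem (Finsupp.weight (fun j => (d j : ℤ)) α + deg j)
          ⟨Finsupp.single j (monomial α c), ?_⟩
        rw [freeProj_single, add_sub_cancel_right,
          weightedHomogeneousComponent_eq_self (monomial_mem_polyGrading α c)]
      | add p q hp hq => rw [Finsupp.single_add]; exact Submodule.add_mem _ hp hq

theorem map_single_eq_smul {M : Type v} [AddCommGroup M] [Module (MvPolynomial (Fin r) K) M]
    (φ : (ι →₀ MvPolynomial (Fin r) K) →ₗ[MvPolynomial (Fin r) K] M) (j : ι)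
    (p : MvPolynomial (Fin r) K) : φ (Finsupp.single j p) = p • φ (Finsupp.single j 1) := by
  rw [← map_smul, Finsupp.smul_single, smul_eq_mul, mul_one]

theorem IsGrading.map_freeProj {M : Type v} [AddCommGroup M] [Module K M]
    [Module (MvPolynomial (Fin r) K) M] {π : ℤ → M →ₗ[K] M} (h : IsGrading d π) {deg : ι → ℤ}
    {φ : (ι →₀ MvPolynomial (Fin r) K) →ₗ[MvPolynomial (Fin r) K] M}
    (hφ : ∀ j, π (deg j) (φ (Finsupp.single j 1)) = φ (Finsupp.single j 1)) (e : ℤ)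
    (f : ι →₀ MvPolynomial (Fin r) K) : φ (freeProj d deg e f) = π e (φ f) := by
  induction f using Finsupp.induction_linear with
  | zero => simp
  | add f g hf hg => simp only [map_add, hf, hg]
  | single j p =>
    rw [freeProj_single]
    induction p using MvPolynomial.induction_on' with
    | monomial α c =>
      have hα := monomial_mem_polyGrading (d := d) α c
      rw [weightedHomogeneousComponent_of_mem hα, map_single_eq_smul φ j (monomial α c),
        h.smul' hα]
      split_ifs with heq
      · rw [map_single_eq_smul, ← hφ j, show e - _ = deg j by rw [← heq]; ring, h.idem]
      · rw [Finsupp.single_zero, map_zero, h.eq_zero_of_ne (hφ j), smul_zero]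
        intro h'
        exact heq (by rw [← h']; ring)
    | add p q hp hq => simp only [map_add, Finsupp.single_add, hp, hq]

theorem apply_mem_ideal {ι' : Type w} (I : Ideal (MvPolynomial (Fin r) K))
    (φ : (ι →₀ MvPolynomial (Fin r) K) →ₗ[MvPolynomial (Fin r) K]
      (ι' →₀ MvPolynomial (Fin r) K))
    {f : ι →₀ MvPolynomial (Fin r) K} (hf : ∀ j, f j ∈ I) (i : ι') : φ f i ∈ I := by
  rw [← Finsupp.sum_single f, Finsupp.sum, map_sum, Finsupp.finsetSum_apply]
  refine Ideal.sum_mem _ fun j _ => ?_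
  rw [map_single_eq_smul, Finsupp.smul_apply, smul_eq_mul]
  exact I.mul_mem_right _ (hf j)

/-- The ideal generated by the first `k` variables. -/
def varIdeal (K : Type u) [Field K] (r k : ℕ) : Ideal (MvPolynomial (Fin r) K) :=
  Ideal.span (X '' {j : Fin r | (j : ℕ) < k})

theorem mem_varIdeal {k : ℕ} {p : MvPolynomial (Fin r) K} :
    p ∈ varIdeal K r k ↔ ∀ α ∈ p.support, ∃ i : Fin r, (i : ℕ) < k ∧ α i ≠ 0 :=
  mem_ideal_span_X_image

theorem varIdeal_self : varIdeal K r r = idealOfVars (Fin r) K := by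
  rw [varIdeal, idealOfVars, ← Set.image_univ]
  congr 2
  ext j
  simp

theorem varIdeal_mono : Monotone (varIdeal K r) := fun _ _ h =>
  Ideal.span_mono (Set.image_mono fun _ hj => lt_of_lt_of_le hj h)

/-- The ideal is monomial, and multiplying a monomial by x_j does not affect its divisibility by
earlier variables. -/
theorem mem_varIdeal_of_X_mul_mem (j : Fin r) {p : MvPolynomial (Fin r) K}
    (h : X j * p ∈ varIdeal K r j) : p ∈ varIdeal K r j := by
  rw [mem_varIdeal] at h ⊢
  intro α hα
  obtain ⟨i, hi, hne⟩ := h (Finsupp.single j 1 + α) (by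
    rw [mem_support_iff, coeff_X_mul]
    exact mem_support_iff.mp hα)
  refine ⟨i, hi, ?_⟩
  have hij : j ≠ i := fun hij => by simp [hij] at hi
  simpa [Finsupp.single_eq_of_ne' hij] using hne

/-- The remainder consists of the monomials of p not divisible by x_j, so an earlier variable
divides each. Monomial division also respects degrees, which supplies homogeneous lifts. -/
theorem sub_X_mul_divMonomial_mem (j : Fin r) {p : MvPolynomial (Fin r) K}
    (h : p ∈ varIdeal K r (j + 1)) :
    p - X j * divMonomial p (Finsupp.single j 1) ∈ varIdeal K r j := by
  rw [sub_eq_of_eq_add' (divMonomial_add_modMonomial_single p j).symm, mem_varIdeal]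
  intro α hα
  rw [mem_support_iff] at hα
  have hle : ¬ Finsupp.single j 1 ≤ α := fun hle => hα (coeff_modMonomial_of_le _ hle)
  rw [coeff_modMonomial_of_not_le _ hle] at hα
  obtain ⟨i, hi, hne⟩ := mem_varIdeal.mp h α (mem_support_iff.mpr hα)
  refine ⟨i, lt_of_le_of_ne (Nat.lt_succ_iff.mp hi) fun hij => hle ?_, hne⟩
  rw [Finsupp.single_le_iff, ← Fin.ext hij]
  omega

theorem divMonomial_mem_polyGrading (j : Fin r) {p : MvPolynomial (Fin r) K} {a : ℤ}
    (h : p ∈ polyGrading K d a) :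
    divMonomial p (Finsupp.single j 1) ∈ polyGrading K d (a - d j) := by
  intro α hα
  rw [coeff_divMonomial] at hα
  have := h hα
  rw [map_add, Finsupp.weight_single, one_smul] at this
  rw [← this, add_sub_cancel_left]

end Free

/-! ### From a graded free resolution to a bigraded complex and its Tor. -/

namespace GradedFreeResolution

variable {K : Type u} [Field K] {r : ℕ} {d : Fin r → ℕ}
  {M : Type v} [AddCommGroup M] [Module K M] [Module (MvPolynomial (Fin r) K) M]
  {ℳ : ℤ → Submodule K M} (F : GradedFreeResolution.{u, v, w} d ℳ)

theorem diff_freeProj (n : ℕ) (e : ℤ) (f : F.ι (n + 1) →₀ MvPolynomial (Fin r) K) :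
    F.diff n (freeProj d (F.deg (n + 1)) e f) = freeProj d (F.deg n) e (F.diff n f) :=
  (isGrading_freeProj (F.deg n)).map_freeProj
    (fun j => freeProj_eq_self_iff.mpr (F.diff_mem n j)) e f

theorem diff_mem_freePiece {n : ℕ} {e : ℤ} {f : F.ι (n + 1) →₀ MvPolynomial (Fin r) K}
    (hf : f ∈ freePiece d (F.deg (n + 1)) e) : F.diff n f ∈ freePiece d (F.deg n) e := by
  rw [← freeProj_eq_self_iff] at hf ⊢
  rw [← F.diff_freeProj, hf]

/-- The total module of a graded free resolution, as a bigraded complex. -/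
def toComplex : BigradedComplex K d (∀ n, F.ι n →₀ MvPolynomial (Fin r) K) where
  piece n e :=
    { carrier := {t | ∀ k, t k ∈ freePiece d (F.deg k) e ∧ ((k : ℤ) ≠ n → t k = 0)}
      zero_mem' := fun k => ⟨Submodule.zero_mem _, fun _ => rfl⟩
      add_mem' := fun {s t} hs ht k => ⟨Submodule.add_mem _ (hs k).1 (ht k).1, fun hk => by
        rw [Pi.add_apply, (hs k).2 hk, (ht k).2 hk, add_zero]⟩
      neg_mem' := fun {t} ht k => ⟨Submodule.neg_mem _ (ht k).1, fun hk => by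
        rw [Pi.neg_apply, (ht k).2 hk, neg_zero]⟩ }
  -- The full product is harmless: every piece is concentrated in a single homological degree.
  diff := LinearMap.pi fun k => F.diff k ∘ₗ LinearMap.proj (k + 1)
  filt k :=
    { carrier := {t | ∀ n j, t n j ∈ varIdeal K r k}
      zero_mem' := fun _ _ => Ideal.zero_mem _
      add_mem' := fun hs ht n j => Ideal.add_mem _ (hs n j) (ht n j)
      smul_mem' := fun p _ ht n j => Ideal.mul_mem_left _ p (ht n j) }
  eq_zero_of_neg := fun {n e t} hn ht => funext fun k => (ht k).2 (by omega)
  smul_mem := fun {a n e t p} hp ht k => ⟨fun j => by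
    have := polyGrading_mul_mem hp ((ht k).1 j)
    rwa [← add_sub_assoc, add_comm a] at this, fun hk => by
      rw [Pi.smul_apply, (ht k).2 hk, smul_zero]⟩
  diff_mem := fun {n e t} ht k => ⟨F.diff_mem_freePiece (ht (k + 1)).1, fun hk => by
    rw [LinearMap.pi_apply, LinearMap.comp_apply, LinearMap.proj_apply,
      (ht (k + 1)).2 (by push_cast; omega), map_zero]⟩
  diff_diff t := funext fun k => (F.exact_succ k).apply_apply_eq_zero _
  diff_mem_filt := fun {k t} ht n j => apply_mem_ideal _ (F.diff n) (ht (n + 1)) j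
  filt_zero := by
    refine (Submodule.eq_bot_iff _).mpr fun t ht => funext fun n => Finsupp.ext fun j => ?_
    have := mem_varIdeal.mp (ht n j)
    exact support_eq_empty.mp (Finset.eq_empty_of_forall_notMem fun α hα => by
      obtain ⟨i, hi, -⟩ := this α hα
      exact Nat.not_lt_zero _ hi)
  filt_mono := fun a b h t ht n j => varIdeal_mono h (ht n j)
  X_smul_mem_filt j t n i := Ideal.mul_mem_right _ _
    (Ideal.subset_span ⟨j, Nat.lt_succ_self _, rfl⟩)
  mem_filt_of_X_smul_mem j t ht n i := mem_varIdeal_of_X_mul_mem j (ht n i)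
  exists_of_mem_filt := fun j {n e t} ht ht' =>
    ⟨fun k => (t k).mapRange (fun p => divMonomial p (Finsupp.single j 1)) (zero_divMonomial _),
      fun k => ⟨fun i => by
        rw [Finsupp.mapRange_apply, sub_right_comm]
        exact divMonomial_mem_polyGrading j ((ht k).1 i), fun hk => by
          beta_reduce
          rw [(ht k).2 hk, Finsupp.mapRange_zero]⟩,
      fun k i => sub_X_mul_divMonomial_mem j (ht' k i)⟩

theorem toComplex_diff_apply (t : ∀ n, F.ι n →₀ MvPolynomial (Fin r) K) (k : ℕ) :
    F.toComplex.diff t k = F.diff k (t (k + 1)) := rfl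

theorem single_mem_piece {n : ℕ} {e : ℤ} {f : F.ι n →₀ MvPolynomial (Fin r) K}
    (hf : f ∈ freePiece d (F.deg n) e) : Pi.single n f ∈ F.toComplex.piece n e := by
  intro k
  by_cases hk : k = n
  · subst hk
    rw [Pi.single_eq_same]
    exact ⟨hf, fun h => absurd rfl h⟩
  · rw [Pi.single_eq_of_ne hk]
    exact ⟨Submodule.zero_mem _, fun _ => rfl⟩

theorem eq_of_mem_piece {n : ℕ} {e : ℤ} {s t : ∀ n, F.ι n →₀ MvPolynomial (Fin r) K}
    (hs : s ∈ F.toComplex.piece n e) (ht : t ∈ F.toComplex.piece n e) (h : s n = t n) : s = t := by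
  funext k
  by_cases hk : k = n
  · subst hk; exact h
  · have hk : (k : ℤ) ≠ n := by exact_mod_cast hk
    rw [(hs k).2 hk, (ht k).2 hk]

theorem exists_diff_eq_of_exists {n : ℕ} {e : ℤ} {t : ∀ n, F.ι n →₀ MvPolynomial (Fin r) K}
    (ht : t ∈ F.toComplex.piece n e) (h : ∃ y, F.diff n y = t n) :
    ∃ v ∈ F.toComplex.piece (n + 1) e, F.toComplex.diff v = t := by
  obtain ⟨y, hy⟩ := h
  -- The preimage y need not be homogeneous; its degree e component still maps to t because the
  -- differential commutes with the projections.
  have hmem : Pi.single (n + 1) (freeProj d (F.deg (n + 1)) e y) ∈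
      F.toComplex.piece ((n + 1 : ℕ) : ℤ) e :=
    F.single_mem_piece (freeProj_eq_self_iff.mp ((isGrading_freeProj _).idem _ _))
  refine ⟨_, hmem, F.eq_of_mem_piece ?_ ht ?_⟩
  · have := F.toComplex.diff_mem hmem
    rwa [Nat.cast_succ, add_sub_cancel_right] at this
  · rw [toComplex_diff_apply, Pi.single_eq_same, F.diff_freeProj, hy,
      freeProj_eq_self_iff.mpr (ht n).1]

theorem toComplex_resolves {π : ℤ → M →ₗ[K] M} (h : IsGrading d π)
    (hπ : ∀ e m, m ∈ ℳ e ↔ π e m = m) :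
    F.toComplex.Resolves π (F.aug ∘ₗ LinearMap.proj 0) := by
  have haug : ∀ e f, F.aug (freeProj d (F.deg 0) e f) = π e (F.aug f) :=
    h.map_freeProj fun j => (hπ _ _).mp (F.aug_mem j)
  refine ⟨fun {e t} ht => ?_, fun {e m} hm => ?_, fun {e t} ht => ?_, fun {e t} ht h0 => ?_,
    fun {n e t} hn ht h0 => ?_⟩
  · rw [LinearMap.comp_apply, LinearMap.proj_apply, ← haug, freeProj_eq_self_iff.mpr (ht 0).1]
  · obtain ⟨f, rfl⟩ := F.aug_surjective m
    refine ⟨Pi.single 0 (freeProj d (F.deg 0) e f),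
      F.single_mem_piece (freeProj_eq_self_iff.mp ((isGrading_freeProj _).idem _ _)), ?_⟩
    rw [LinearMap.comp_apply, LinearMap.proj_apply, Pi.single_eq_same, haug, hm]
  · exact F.exact_zero.apply_apply_eq_zero _
  · have := F.exists_diff_eq_of_exists (n := 0) ht ((F.exact_zero _).mp h0)
    simpa using this
  · obtain ⟨k, rfl⟩ : ∃ k : ℕ, n = (k + 1 : ℕ) := ⟨(n - 1).toNat, by omega⟩
    exact F.exists_diff_eq_of_exists ht ((F.exact_succ k _).mp (congrFun h0 k))

theorem mapRange_diff (n : ℕ) (f : F.ι (n + 1) →₀ MvPolynomial (Fin r) K) :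
    (F.diff n f).mapRange constantCoeff (map_zero _) =
      F.chainDiff n (f.mapRange constantCoeff (map_zero _)) := by
  induction f using Finsupp.induction_linear with
  | zero => simp
  | add f g hf hg =>
    rw [map_add, Finsupp.mapRange_add (map_add _), hf, hg, Finsupp.mapRange_add (map_add _),
      map_add]
  | single j p =>
    rw [map_single_eq_smul, Finsupp.mapRange_single, chainDiff, Finsupp.linearCombination_single]
    ext i
    simp

/-- Cycles of F ⊗ K lift to F with constant coefficients, keeping their degree. Being a cycle then
means that the differential of the lift lies in the irrelevant ideal times F, and taking constant
coefficients of a bounding element bounds the original cycle. -/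
theorem torPiece_eq_bot {i : ℕ} {e : ℤ} (h : F.toComplex.HomologyVanishes r i e) :
    F.torPiece i e = ⊥ := by
  rw [torPiece, Submodule.eq_bot_iff]
  rintro _ ⟨c, ⟨hc, hcyc⟩, rfl⟩
  have hcc : (c.mapRange (C : K → MvPolynomial (Fin r) K) (map_zero _)).mapRange constantCoeff
      (map_zero _) = c := by
    ext j
    simp
  have hmem : c.mapRange (C : K → MvPolynomial (Fin r) K) (map_zero _) ∈
      freePiece d (F.deg i) e := by
    intro j
    rw [Finsupp.mapRange_apply]
    by_cases hj : c j = 0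
    · rw [hj, map_zero]; exact Submodule.zero_mem _
    · have : F.deg i j = e := hc (Finsupp.mem_support_iff.mpr hj)
      rw [this, sub_self]
      exact isWeightedHomogeneous_C _ _
  obtain ⟨v, -, hv⟩ := h _ (F.single_mem_piece hmem) (by
    intro n j
    rw [toComplex_diff_apply, varIdeal_self, mem_idealOfVars_iff]
    by_cases hn : n + 1 = i
    · subst hn
      rw [Pi.single_eq_same, ← Finsupp.mapRange_apply (hf := map_zero _), mapRange_diff, hcc]
      exact DFunLike.congr_fun (LinearMap.mem_ker.mp hcyc) j
    · rw [Pi.single_eq_of_ne hn, map_zero, Finsupp.zero_apply, map_zero])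
  refine (Submodule.Quotient.mk_eq_zero _).mpr ⟨(v (i + 1)).mapRange constantCoeff (map_zero _), ?_⟩
  rw [← mapRange_diff]
  ext j
  have := hv i j
  rw [varIdeal_self, mem_idealOfVars_iff, Pi.sub_apply, Pi.single_eq_same, toComplex_diff_apply,
    Finsupp.sub_apply, map_sub, Finsupp.mapRange_apply, constantCoeff_C, sub_eq_zero] at this
  rw [Finsupp.mapRange_apply, this]

end GradedFreeResolution

/-! ### Projections of a decomposition, and assembly. -/

section Decomposition

variable {K : Type u} [Field K] {r : ℕ} {d : Fin r → ℕ}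
  {M : Type v} [AddCommGroup M] [Module K M] [Module (MvPolynomial (Fin r) K) M]
  (ℳ : ℤ → Submodule K M) [DirectSum.Decomposition ℳ]

/-- The projection onto the degree `e` piece of a graded module. -/
def decompositionProj (e : ℤ) : M →ₗ[K] M :=
  (ℳ e).subtype ∘ₗ DirectSum.component K ℤ (fun e => ℳ e) e ∘ₗ
    (DirectSum.decomposeLinearEquiv ℳ).toLinearMap

theorem decompositionProj_apply (e : ℤ) (m : M) :
    decompositionProj ℳ e m = (DirectSum.decompose ℳ m e : M) := rfl

theorem mem_iff_decompositionProj_eq {e : ℤ} {m : M} :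
    m ∈ ℳ e ↔ decompositionProj ℳ e m = m := by
  rw [decompositionProj_apply]
  exact ⟨DirectSum.decompose_of_mem_same ℳ, fun h => h ▸ Subtype.property _⟩

theorem isGrading_decompositionProj [SetLike.GradedSMul (polyGrading K d) ℳ] :
    IsGrading d (decompositionProj ℳ) where
  idem e m := (mem_iff_decompositionProj_eq ℳ).mp (Subtype.property _)
  orth e e' m hne := DirectSum.decompose_of_mem_ne ℳ (Subtype.property _) hne.symm
  smul a e p m hp := by
    induction m using DirectSum.Decomposition.inductionOn ℳ with
    | zero => simp
    | @homogeneous e' m =>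
      have hm : p • (m : M) ∈ ℳ (a + e') := SetLike.GradedSMul.smul_mem hp m.2
      simp only [decompositionProj_apply]
      by_cases he : e' = e
      · subst he
        rw [add_comm, DirectSum.decompose_of_mem_same ℳ hm, DirectSum.decompose_of_mem_same ℳ m.2]
      · rw [DirectSum.decompose_of_mem_ne ℳ hm (by omega),
          DirectSum.decompose_of_mem_ne ℳ m.2 he, smul_zero]
    | add m m' hm hm' => rw [smul_add, map_add, hm, hm', map_add, smul_add]
  mem_iSup m := by
    induction m using DirectSum.Decomposition.inductionOn ℳ with
    | zero => exact Submodule.zero_mem _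
    | @homogeneous e m =>
      exact Submodule.mem_iSup_of_mem e ⟨m, (mem_iff_decompositionProj_eq ℳ).mp m.2⟩
    | add m m' hm hm' => exact Submodule.add_mem _ hm hm'

theorem range_decompositionProj (e : ℤ) : LinearMap.range (decompositionProj ℳ e) = ℳ e := by
  ext m
  refine ⟨?_, fun hm => ⟨m, (mem_iff_decompositionProj_eq ℳ).mp hm⟩⟩
  rintro ⟨x, rfl⟩
  exact Subtype.property _

end Decomposition

/-- The local dimension n need only be at most s, since the final bound grows with n; a zero
localization is recorded as n = 0. -/
theorem IsCohenMacaulay.exists_isRegular {R : Type u} [CommRing R] {M : Type v} [AddCommGroup M]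
    [Module R M] [Module.Finite R M] (h : IsCohenMacaulay R M) (P : Ideal R) [P.IsMaximal] {s : ℕ}
    (hs : Nontrivial M → Module.supportDim R M = (s : ℕ∞)) :
    ∃ n ≤ s, Module.supportDim (Localization.AtPrime P) (LocalizedModule P.primeCompl M) ≤
        (n : ℕ∞) ∧ (n = 0 ∨ ∃ rs : List (Localization.AtPrime P), rs.length = n ∧
          (∀ x ∈ rs, x ∈ maximalIdeal _) ∧
          RingTheory.Sequence.IsRegular (LocalizedModule P.primeCompl M) rs) := by
  rcases subsingleton_or_nontrivial (LocalizedModule P.primeCompl M) with hN | hN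
  · refine ⟨0, Nat.zero_le _, ?_, Or.inl rfl⟩
    rw [Module.supportDim_eq_bot_of_subsingleton]
    exact bot_le
  have hM : Nontrivial M := by
    by_contra hM
    rw [not_nontrivial_iff_subsingleton] at hM
    refine not_subsingleton (LocalizedModule P.primeCompl M) ⟨fun x y => ?_⟩
    obtain ⟨⟨m, c⟩, rfl⟩ := IsLocalizedModule.mk'_surjective P.primeCompl
      (LocalizedModule.mkLinearMap P.primeCompl M) x
    obtain ⟨⟨m', c'⟩, rfl⟩ := IsLocalizedModule.mk'_surjective P.primeCompl
      (LocalizedModule.mkLinearMap P.primeCompl M) y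
    simp [Subsingleton.elim m 0, Subsingleton.elim m' 0]
  have hdepth := (h P).resolve_left (not_subsingleton _)
  have hle := supportDim_localizedModule_le P M
  rw [hs hM, ← hdepth, WithBot.coe_le_coe] at hle
  obtain ⟨n, hn⟩ := ENat.ne_top_iff_exists.mp (ne_top_of_le_ne_top (ENat.natCast_ne_top s) hle)
  refine ⟨n, by rw [← hn] at hle; exact_mod_cast hle, by rw [← hdepth, ← hn], ?_⟩
  by_cases h0 : n = 0
  · exact Or.inl h0
  · exact Or.inr (exists_isRegular_length_eq h0 hn.symm)

end SyzygyBound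

end

theorem theorem3 {K : Type u} [Field K] {r : ℕ} (d : Fin r → ℕ)
    (hd_pos : ∀ j, 0 < d j) (hd : Antitone d)
    {M : Type v} [AddCommGroup M] [Module K M] [Module (MvPolynomial (Fin r) K) M]
    [IsScalarTower K (MvPolynomial (Fin r) K) M] [Module.Finite (MvPolynomial (Fin r) K) M]
    (ℳ : ℤ → Submodule K M) [DirectSum.Decomposition ℳ]
    [SetLike.GradedSMul (SyzygyBound.polyGrading K d) ℳ]
    (hCM : SyzygyBound.IsCohenMacaulay (MvPolynomial (Fin r) K) M)
    (s : ℕ) (hs : Nontrivial M → Module.supportDim (MvPolynomial (Fin r) K) M = (s : ℕ∞)) :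
    ∃ H : RatFunc ℚ, SyzygyBound.IsHilbertSeries ℳ H ∧
      ∀ (F : SyzygyBound.GradedFreeResolution.{u, v, w} d ℳ) (i : ℕ),
        SyzygyBound.gradedDegree (F.torPiece i) ≤
          (((∑ j ∈ Finset.univ.filter (fun j : Fin r => (j : ℕ) < s + i), (d j : ℤ) : ℤ) : WithTop ℤ) :
            WithBot (WithTop ℤ)) + SyzygyBound.ratDegree H := by
  have hπ := SyzygyBound.isGrading_decompositionProj (d := d) ℳ
  obtain ⟨n, hns, hdim, hreg⟩ :=
    hCM.exists_isRegular (MvPolynomial.idealOfVars (Fin r) K) hs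
  obtain ⟨H, hH, hbound⟩ :=
    SyzygyBound.exists_hilbertSeries_and_bound.{u, v, max u w} hd_pos hd n hπ hdim hreg
  simp only [SyzygyBound.range_decompositionProj] at hH
  refine ⟨H, hH, fun F i => iSup₂_le fun e he => ?_⟩
  have hF := hbound (F.toComplex_resolves hπ fun e m =>
    SyzygyBound.mem_iff_decompositionProj_eq ℳ) i e
  -- Read contrapositively: a nonzero Tor piece in degree e forces both H ≠ 0 and the bound on e.
  have hlt : ¬ (H ≠ 0 → H.intDegree + SyzygyBound.partialSum d (n + i) < e) :=
    fun h => he (F.torPiece_eq_bot (hF h))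
  rw [Classical.not_imp, not_lt] at hlt
  rw [SyzygyBound.ratDegree, if_neg hlt.1]
  have hle : e ≤ SyzygyBound.partialSum d (s + i) + H.intDegree := by
    have := SyzygyBound.partialSum_mono d (Nat.add_le_add_right hns i)
    linarith [hlt.2]
  rw [SyzygyBound.partialSum] at hle
  exact_mod_cast hle
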